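/- **Setting.** Let $\mathcal G$ be a metric star graph with $N\ge 1$ edges identified with $(0,l_i)$, $l_i>0$ ($x=0$ is the common vertex), let $T>0$, $D_i>0$, $\underline D=\min_i D_i$, $\bar D=\max_i D_i$, and $Q_i=(0,l_i)\times(0,T)$. Put $\mathbb L^2=\prod_i L^2(0,l_i)$, $\mathbb H^1=\prod_i H^1(0,l_i)$ (with the product Hilbert norms), $\mathbb L^\infty=\prod_i L^\infty(Q_i)$ with $\|u\|_{\mathbb L^\infty}=\sum_i\|u_i\|_{L^\infty(Q_i)}$, $$\mathbb V=\{\varphi\in\mathbb H^1:\ \varphi_i(0)=\varphi_j(0),\ \varphi_i(l_i)=0 \text{ for all } i,j\}$$ with the $\mathbb H^1$ norm, $\mathbb V\hookrightarrow\mathbb L^2\hookrightarrow\mathbb V^\star$, and $$\mathbb W(0,T)=\{\rho\in L^2(0,T;\mathbb V):\ \rho_t\in L^2(0,T;\mathbb V^\star)\},\qquad \|\rho\|_{\mathbb W(0,T)}^2=\|\rho\|_{L^2(0,T;\mathbb V)}^2+\|\rho_t\|_{L^2(0,T;\mathbb V^\star)}^2 .$$ Elements of $\mathbb W(0,T)$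 are identified with their representatives in $C([0,T];\mathbb L^2)$. For $u\in\mathbb L^\infty$ and $\varphi,\chi\in\mathbb V$ let $$\mathcal F[u](\varphi,\chi)=\sum_{i=1}^N\int_0^{l_i}\Big(D_i\frac{\partial\varphi_i}{\partial x}+u_i\varphi_i\Big)\frac{\partial\chi_i}{\partial x}\,dx$$ (for a.e. $t\in(0,T)$). Let $\rho^0\in\mathbb L^2$, and let $\rho\in\mathbb W(0,T)$ be the weak solution of the state equation, i.e. $\langle\rho_t,\cdot\rangle+\mathcal F[u](\rho,\cdot)=0$ in $L^2(0,T;\mathbb V^\star)$ and $\rho(\cdot,0)=\rho^0$ in $\mathbb L^2$. **Proposition.** Let $\rho^d\in L^2(0,T;\mathbb L^2)$, $\rho^T\in\mathbb L^2$ and $u\in\mathbb L^\infty$. Then there exists a unique $q\in\mathbb W(0,T)$ with $$-\langle q_t,\cdot\rangle+\mathcal F[u](\cdot,q)=\langle\rho-\rho^d,\cdot\rangle\ \text{ in } L^2(0,T;\mathbb V^\star),\qquad q(\cdot,T)=\rho(\cdot,T)-\rho^T\ \text{ in }\mathbb L^2,$$ that is, a unique weak solution of the adjoint equation $-\partial_tq_i-D_i\partial_{xx}q_i+u_i\partial_xq_i=\rho_i-\rho_i^d$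 in $Q_i$ with $q_i(x,T)=\rho_i(x,T)-\rho_i^T(x)$, $\sum_iD_i\partial_xq_i(0,t)=0$, $q_i(0,t)=q_j(0,t)$, $q_i(l_i,t)=0$. Moreover, there is a constant $C>0$, depending only on $T$, $\underline D$, $\bar D$ and, continuously, on $\|u\|_{\mathbb L^\infty}$, such that $$\|q\|_{\mathbb W(0,T)}\le C\big(\|\rho^0\|_{\mathbb L^2}+\|\rho^d\|_{L^2(0,T;\mathbb L^2)}+\|\rho^T\|_{\mathbb L^2}\big).$$ -/

import Mathlib

open MeasureTheory Set
open scoped ENNReal ContDiff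

noncomputable section

namespace StarGraph

/-- Smooth real test functions with compact support in the open interval `(0, a)`. -/
structure IsTestFun (a : ℝ) (φ : ℝ → ℝ) : Prop where
  smooth : ContDiff ℝ ∞ φ
  compact : HasCompactSupport φ
  supp : tsupport φ ⊆ Ioo 0 a

/-- Lebesgue measure on the interval `(0, a)`. -/
abbrev intervalMeasure (a : ℝ) : Measure ℝ := volume.restrict (Ioo 0 a)

/-- Lebesgue measure on the rectangle `(0, a) × (0, T)`; points are written `(x, t)`. -/
abbrev rectMeasure (a T : ℝ) : Measure (ℝ × ℝ) := volume.restrict (Ioo 0 a ×ˢ Ioo 0 T)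

theorem IsTestFun.exists_bound {a : ℝ} {φ : ℝ → ℝ} (h : IsTestFun a φ) : ∃ C, ∀ x, ‖φ x‖ ≤ C :=
  h.compact.exists_bound_of_continuous h.smooth.continuous

theorem IsTestFun.continuous_deriv {a : ℝ} {φ : ℝ → ℝ} (h : IsTestFun a φ) :
    Continuous (deriv φ) :=
  h.smooth.continuous_deriv (by simp)

theorem IsTestFun.integrable_mul {a b : ℝ} {φ f : ℝ → ℝ} (h : IsTestFun a φ)
    (hf : MemLp f 2 (intervalMeasure b)) :
    Integrable (fun x => f x * φ x) (intervalMeasure b) := by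
  obtain ⟨C, hC⟩ := h.exists_bound
  exact (hf.integrable one_le_two).mul_bdd h.smooth.continuous.aestronglyMeasurable
    (Filter.Eventually.of_forall hC)

theorem IsTestFun.integrable_mul_deriv {a b : ℝ} {φ f : ℝ → ℝ} (h : IsTestFun a φ)
    (hf : MemLp f 2 (intervalMeasure b)) :
    Integrable (fun x => f x * deriv φ x) (intervalMeasure b) := by
  obtain ⟨C, hC⟩ := h.compact.deriv.exists_bound_of_continuous h.continuous_deriv
  exact (hf.integrable one_le_two).mul_bdd h.continuous_deriv.aestronglyMeasurable
    (Filter.Eventually.of_forall hC)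

section Evolution

variable {E H : Type*} [NormedAddCommGroup E] [InnerProductSpace ℝ E]
  [NormedAddCommGroup H] [InnerProductSpace ℝ H]

/-- `σ ∈ L²(0,T;V*)` is the weak time derivative of `ρ ∈ L²(0,T;V)`, for Hilbert
spaces `V = E ⊂ H ⊂ V*` where `j : E → H` is the embedding and `H` is embedded in `V*` by the inner
product of `H`: `d/dt (ρ(t), φ)_H = ⟨σ(t), φ⟩` as distributions on `(0, T)` for all `φ ∈ V`. -/
def HasWeakTimeDeriv (j : E →L[ℝ] H) {T : ℝ} (ρ : Lp E 2 (intervalMeasure T))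
    (σ : Lp (StrongDual ℝ E) 2 (intervalMeasure T)) : Prop :=
  ∀ (φ : E) (ψ : ℝ → ℝ), IsTestFun T ψ →
    ∫ t, inner ℝ (j (ρ t)) (j φ) * deriv ψ t ∂intervalMeasure T
      = -∫ t, σ t φ * ψ t ∂intervalMeasure T

theorem memLp_inner (j : E →L[ℝ] H) {T : ℝ} (ρ : Lp E 2 (intervalMeasure T)) (φ : E) :
    MemLp (fun t => inner ℝ (j (ρ t)) (j φ)) 2 (intervalMeasure T) :=
  MemLp.inner_const (j.comp_memLp' (Lp.memLp ρ)) (j φ)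

theorem memLp_pairing {T : ℝ} (σ : Lp (StrongDual ℝ E) 2 (intervalMeasure T))
    (φ : E) : MemLp (fun t => σ t φ) 2 (intervalMeasure T) :=
  (ContinuousLinearMap.apply ℝ ℝ φ : StrongDual ℝ E →L[ℝ] ℝ).comp_memLp' (Lp.memLp σ)

/-- The space `W(0,T)` for `V = E ⊂ H ⊂ V*`: an element is a pair `(ρ, ρ_t)` in `L²(0,T;V) × L²(0,T;V*)` where `ρ_t` is
the weak time derivative of `ρ` (and so is determined by `ρ` when `V` is separable), with norm
`‖ρ‖² = ‖ρ‖²_{L²(0,T;V)} + ‖ρ_t‖²_{L²(0,T;V*)}`. -/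
def EvolutionSpace (j : E →L[ℝ] H) (T : ℝ) :
    Submodule ℝ (WithLp 2 (Lp E 2 (intervalMeasure T) × Lp (StrongDual ℝ E) 2 (intervalMeasure T))) where
  carrier := {w | HasWeakTimeDeriv j w.fst w.snd}
  zero_mem' := by
    intro φ ψ _
    rw [integral_eq_zero_of_ae, integral_eq_zero_of_ae, neg_zero]
    · filter_upwards [Lp.coeFn_zero (StrongDual ℝ E) 2 (intervalMeasure T)] with t ht
      rw [WithLp.zero_snd, ht, Pi.zero_apply, zero_apply, zero_mul, Pi.zero_apply]
    · filter_upwards [Lp.coeFn_zero E 2 (intervalMeasure T)] with t ht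
      rw [WithLp.zero_fst, ht, Pi.zero_apply, map_zero, inner_zero_left, zero_mul, Pi.zero_apply]
  add_mem' := by
    intro w z hw hz φ ψ hψ
    have e : ∫ t, inner ℝ (j ((w + z).fst t)) (j φ) * deriv ψ t ∂intervalMeasure T
        = ∫ t, (inner ℝ (j (w.fst t)) (j φ) * deriv ψ t
          + inner ℝ (j (z.fst t)) (j φ) * deriv ψ t) ∂intervalMeasure T := by
      refine integral_congr_ae ?_
      filter_upwards [Lp.coeFn_add w.fst z.fst] with t ht
      rw [WithLp.add_fst, ht, Pi.add_apply, map_add, inner_add_left, add_mul]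
    have e' : ∫ t, (w + z).snd t φ * ψ t ∂intervalMeasure T
        = ∫ t, (w.snd t φ * ψ t + z.snd t φ * ψ t) ∂intervalMeasure T := by
      refine integral_congr_ae ?_
      filter_upwards [Lp.coeFn_add w.snd z.snd] with t ht
      rw [WithLp.add_snd, ht, Pi.add_apply, add_apply, add_mul]
    rw [e, e', integral_add (hψ.integrable_mul_deriv (memLp_inner j _ φ))
      (hψ.integrable_mul_deriv (memLp_inner j _ φ)),
      integral_add (hψ.integrable_mul (memLp_pairing _ φ)) (hψ.integrable_mul (memLp_pairing _ φ)),
      hw φ ψ hψ, hz φ ψ hψ, neg_add]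
  smul_mem' := by
    intro c w hw φ ψ hψ
    have e : ∫ t, inner ℝ (j ((c • w).fst t)) (j φ) * deriv ψ t ∂intervalMeasure T
        = ∫ t, c * (inner ℝ (j (w.fst t)) (j φ) * deriv ψ t) ∂intervalMeasure T := by
      refine integral_congr_ae ?_
      filter_upwards [Lp.coeFn_smul c w.fst] with t ht
      rw [WithLp.smul_fst, ht, Pi.smul_apply, map_smul, real_inner_smul_left, mul_assoc]
    have e' : ∫ t, (c • w).snd t φ * ψ t ∂intervalMeasure T
        = ∫ t, c * (w.snd t φ * ψ t) ∂intervalMeasure T := by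
      refine integral_congr_ae ?_
      filter_upwards [Lp.coeFn_smul c w.snd] with t ht
      rw [WithLp.smul_snd, ht, Pi.smul_apply, smul_apply, smul_eq_mul, mul_assoc]
    rw [e, e', integral_const_mul, integral_const_mul, hw φ ψ hψ, mul_neg]

end Evolution

variable {N : ℕ}

/-- `∏ L²(0, lᵢ)` with its Hilbert space structure. -/
abbrev L2 (l : Fin N → ℝ) : Type :=
  PiLp 2 (fun i : Fin N => Lp ℝ 2 (intervalMeasure (l i)))

/-- `∏ L^∞((0, lᵢ) × (0, T))`, with norm `∑ ‖uᵢ‖_{L^∞}`. -/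
abbrev LInf (l : Fin N → ℝ) (T : ℝ) : Type :=
  PiLp 1 (fun i : Fin N => Lp ℝ ∞ (rectMeasure (l i) T))

/-- `g` is the weak derivative of `f` on `(0, a)`. -/
def HasWeakDeriv (a : ℝ) (f g : ℝ → ℝ) : Prop :=
  ∀ φ, IsTestFun a φ →
    ∫ x, f x * deriv φ x ∂intervalMeasure a = -∫ x, g x * φ x ∂intervalMeasure a

/-- `∏ H¹(0, lᵢ)`: an element is a pair `(φ, φ')` in `L² × L²` such that each `φᵢ'` is the weak
derivative of `φᵢ`. The norm is `‖(φ, φ')‖² = ‖φ‖² + ‖φ'‖²`, i.e. the `H¹` norm. -/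
def H1 (l : Fin N → ℝ) : Submodule ℝ (WithLp 2 (L2 l × L2 l)) where
  carrier := {p | ∀ i, HasWeakDeriv (l i) (p.fst i) (p.snd i)}
  zero_mem' := by
    intro i φ _
    have h : (((0 : WithLp 2 (L2 l × L2 l)).fst i : Lp ℝ 2 (intervalMeasure (l i))) : ℝ → ℝ)
        =ᵐ[intervalMeasure (l i)] 0 := Lp.coeFn_zero ℝ 2 _
    have h' : (((0 : WithLp 2 (L2 l × L2 l)).snd i : Lp ℝ 2 (intervalMeasure (l i))) : ℝ → ℝ)
        =ᵐ[intervalMeasure (l i)] 0 := Lp.coeFn_zero ℝ 2 _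
    rw [integral_eq_zero_of_ae, integral_eq_zero_of_ae, neg_zero]
    · filter_upwards [h'] with x hx
      exact mul_eq_zero_of_left hx _
    · filter_upwards [h] with x hx
      exact mul_eq_zero_of_left hx _
  add_mem' := by
    intro p q hp hq i φ hφ
    have h := Lp.coeFn_add (p.fst i) (q.fst i)
    have h' := Lp.coeFn_add (p.snd i) (q.snd i)
    have e : ∫ x, ((p + q).fst i) x * deriv φ x ∂intervalMeasure (l i)
        = ∫ x, ((p.fst i) x * deriv φ x + (q.fst i) x * deriv φ x) ∂intervalMeasure (l i) := by
      refine integral_congr_ae ?_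
      filter_upwards [h] with x hx
      rw [WithLp.add_fst, PiLp.add_apply, hx, Pi.add_apply, add_mul]
    have e' : ∫ x, ((p + q).snd i) x * φ x ∂intervalMeasure (l i)
        = ∫ x, ((p.snd i) x * φ x + (q.snd i) x * φ x) ∂intervalMeasure (l i) := by
      refine integral_congr_ae ?_
      filter_upwards [h'] with x hx
      rw [WithLp.add_snd, PiLp.add_apply, hx, Pi.add_apply, add_mul]
    rw [e, e', integral_add (hφ.integrable_mul_deriv (Lp.memLp _))
      (hφ.integrable_mul_deriv (Lp.memLp _)), integral_add (hφ.integrable_mul (Lp.memLp _))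
      (hφ.integrable_mul (Lp.memLp _)), hp i φ hφ, hq i φ hφ, neg_add]
  smul_mem' := by
    intro c p hp i φ hφ
    have h := Lp.coeFn_smul c (p.fst i)
    have h' := Lp.coeFn_smul c (p.snd i)
    have e : ∫ x, ((c • p).fst i) x * deriv φ x ∂intervalMeasure (l i)
        = ∫ x, c * ((p.fst i) x * deriv φ x) ∂intervalMeasure (l i) := by
      refine integral_congr_ae ?_
      filter_upwards [h] with x hx
      rw [WithLp.smul_fst, PiLp.smul_apply, hx, Pi.smul_apply, smul_eq_mul, mul_assoc]
    have e' : ∫ x, ((c • p).snd i) x * φ x ∂intervalMeasure (l i)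
        = ∫ x, c * ((p.snd i) x * φ x) ∂intervalMeasure (l i) := by
      refine integral_congr_ae ?_
      filter_upwards [h'] with x hx
      rw [WithLp.smul_snd, PiLp.smul_apply, hx, Pi.smul_apply, smul_eq_mul, mul_assoc]
    rw [e, e', integral_const_mul, integral_const_mul, hp i φ hφ, mul_neg]

/-- The vertex conditions for a function on the star graph, read off from the continuous
representatives on the closed edges `[0, lᵢ]`: continuity at the common vertex `x = 0` and
homogeneous Dirichlet conditions at the outer vertices `x = lᵢ`. -/
def VertexConditions (l : Fin N → ℝ) (f : L2 l) : Prop :=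
  ∃ F : Fin N → ℝ → ℝ,
    (∀ i, ContinuousOn (F i) (Icc 0 (l i)) ∧ f i =ᵐ[intervalMeasure (l i)] F i) ∧
    (∀ i j, F i 0 = F j 0) ∧ ∀ i, F i (l i) = 0

/-- The space `V` of all `φ ∈ ∏ H¹(0, lᵢ)` satisfying the vertex conditions, with the `H¹` norm. -/
def energySubmodule (l : Fin N → ℝ) : Submodule ℝ (WithLp 2 (L2 l × L2 l)) where
  carrier := {p | p ∈ H1 l ∧ VertexConditions l p.fst}
  zero_mem' :=
    ⟨(H1 l).zero_mem, fun _ _ => 0, fun _ => ⟨continuousOn_const, Lp.coeFn_zero ℝ 2 _⟩,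
      fun _ _ => rfl, fun _ => rfl⟩
  add_mem' := by
    rintro p q ⟨hp, F, hF, hF0, hFl⟩ ⟨hq, G, hG, hG0, hGl⟩
    refine ⟨(H1 l).add_mem hp hq, fun i x => F i x + G i x,
      fun i => ⟨(hF i).1.add (hG i).1, ?_⟩, fun i j => ?_, fun i => ?_⟩
    · filter_upwards [Lp.coeFn_add (p.fst i) (q.fst i), (hF i).2, (hG i).2] with x hx h1 h2
      rw [WithLp.add_fst, PiLp.add_apply, hx, Pi.add_apply, h1, h2]
    · simp only [hF0 i j, hG0 i j]
    · simp [hFl i, hGl i]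
  smul_mem' := by
    rintro c p ⟨hp, F, hF, hF0, hFl⟩
    refine ⟨(H1 l).smul_mem c hp, fun i x => c * F i x,
      fun i => ⟨continuousOn_const.mul (hF i).1, ?_⟩, fun i j => ?_, fun i => ?_⟩
    · filter_upwards [Lp.coeFn_smul c (p.fst i), (hF i).2] with x hx h1
      rw [WithLp.smul_fst, PiLp.smul_apply, hx, Pi.smul_apply, h1, smul_eq_mul]
    · simp only [hF0 i j]
    · simp [hFl i]

/-- The Hilbert space `V` as a type, with the inner product inherited from `∏ H¹(0, lᵢ)`. -/
def V (l : Fin N → ℝ) : Type := energySubmodule l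

instance instNormedAddCommGroupV (l : Fin N → ℝ) : NormedAddCommGroup (V l) :=
  inferInstanceAs (NormedAddCommGroup (energySubmodule l))

instance instInnerProductSpaceV (l : Fin N → ℝ) : InnerProductSpace ℝ (V l) :=
  inferInstanceAs (InnerProductSpace ℝ (energySubmodule l))

/-- The embedding of `V` into `∏ L²(0, lᵢ)`. -/
def toL2 {l : Fin N → ℝ} : V l →L[ℝ] L2 l :=
  (WithLp.fstL 2 ℝ (L2 l) (L2 l)).comp (energySubmodule l).subtypeL

/-- The weak derivative in space of an element of `V`. -/
def dx {l : Fin N → ℝ} : V l →L[ℝ] L2 l :=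
  (WithLp.sndL 2 ℝ (L2 l) (L2 l)).comp (energySubmodule l).subtypeL

/-- The space `W(0,T)` on the star graph. -/
abbrev W (l : Fin N → ℝ) (T : ℝ) : Type := EvolutionSpace (E := V l) (H := L2 l) toL2 T

/-- The `L²(0,T;V)` function underlying an element of `W(0,T)`. -/
def W.fn {l : Fin N → ℝ} {T : ℝ} (w : W l T) : Lp (V l) 2 (intervalMeasure T) := w.1.fst

/-- The weak time derivative of an element of `W(0,T)`. -/
def W.dt {l : Fin N → ℝ} {T : ℝ} (w : W l T) :
    Lp (StrongDual ℝ (V l)) 2 (intervalMeasure T) := w.1.snd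

/-- `R` is the representative of `w ∈ W(0,T)` in `C([0,T]; ∏ L²(0, lᵢ))`. -/
structure IsContRep {l : Fin N → ℝ} {T : ℝ} (w : W l T) (R : ℝ → L2 l) : Prop where
  continuousOn : ContinuousOn R (Icc 0 T)
  ae_eq : ∀ᵐ t ∂intervalMeasure T, R t = toL2 (W.fn w t)

/-- The bilinear form at time `t`:
`F[u(t)](φ, χ) = ∑ᵢ ∫₀^{lᵢ} (Dᵢ φᵢ'(x) + uᵢ(x, t) φᵢ(x)) χᵢ'(x) dx`. -/
def form {l : Fin N → ℝ} {T : ℝ} (D : Fin N → ℝ) (u : LInf l T) (t : ℝ) (φ χ : V l) : ℝ :=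
  ∑ i, ∫ x, (D i * dx φ i x + u i (x, t) * toL2 φ i x) * dx χ i x ∂intervalMeasure (l i)

/-- `ρ ∈ W(0,T)` is a weak solution of the state equation
`∂ₜρᵢ - Dᵢ ∂ₓₓρᵢ - ∂ₓ(uᵢ ρᵢ) = 0`, `ρ(·, 0) = ρ⁰`:
`⟨ρ_t, ·⟩ + F[u](ρ, ·) = 0` in `L²(0,T;V*)`, and `ρ(·, 0) = ρ⁰` in `∏ L²(0, lᵢ)`. -/
structure IsStateSolution {l : Fin N → ℝ} {T : ℝ} (D : Fin N → ℝ) (u : LInf l T) (ρ0 : L2 l)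
    (ρ : W l T) : Prop where
  equation : ∀ᵐ t ∂intervalMeasure T, ∀ φ : V l,
    W.dt ρ t φ + form D u t (W.fn ρ t) φ = 0
  initial : ∃ R, IsContRep ρ R ∧ R 0 = ρ0

/-- `q ∈ W(0,T)` is a weak solution of the adjoint equation
`-∂ₜqᵢ - Dᵢ ∂ₓₓqᵢ + uᵢ ∂ₓqᵢ = ρᵢ - ρᵢᵈ`, `q(·, T) = ρ(·, T) - ρᵀ`:
`-⟨q_t, ·⟩ + F[u](·, q) = ⟨ρ - ρᵈ, ·⟩` in `L²(0,T;V*)`, and `q(·, T) = ρ(·, T) - ρᵀ` in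
`∏ L²(0, lᵢ)`. -/
structure IsAdjointSolution {l : Fin N → ℝ} {T : ℝ} (D : Fin N → ℝ) (u : LInf l T)
    (ρ : W l T) (ρd : Lp (L2 l) 2 (intervalMeasure T)) (ρT : L2 l) (q : W l T) : Prop where
  equation : ∀ᵐ t ∂intervalMeasure T, ∀ φ : V l,
    -W.dt q t φ + form D u t φ (W.fn q t) = inner ℝ (toL2 (W.fn ρ t) - ρd t) (toL2 φ)
  terminal : ∃ R Q, IsContRep ρ R ∧ IsContRep q Q ∧ Q T = R T - ρT

end StarGraph

end

/-! The theorem is an instance of a statement about backward parabolic problems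
`-∂ₜq + A(t) q = F`, `q(T) = g` in a Hilbert triple `V → H → V*`, where the forms satisfy a Gårding
inequality `α ‖e‖²_V ≤ a(t; e, e) + κ ‖e‖²_H`.

**Energy identity.** For `f ∈ L²(a,b;V)` with weak derivative `σ ∈ L²(a,b;V*)` one has
`d/dt ‖f‖²_H = 2 ⟨σ, f⟩` (`isWeakDerivOn_norm_sq`). By the du Bois-Reymond lemma
(`IsWeakDerivOn.exists_ae_eq`) `f` is a primitive of `σ` in `V*`; as the embedding `V → V*` is
symmetric, the increment `‖f(t + h)‖² - ‖f(t)‖²` is the pairing of `∫₀ʰ σ(t + τ) dτ` with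
`f(t + h) + f(t)`, and the limit of the difference quotient follows from the continuity of
translations in `L²`. With the weight `e^{2κt}` and Gårding's inequality this gives the a priori
bounds `forward_estimate` for the state and `backward_estimate` for the adjoint, and with the latter
also uniqueness.

**Existence.** The a priori bounds make the solvable data `(F, g)` a closed subspace of
`L²(0,T;V*) × H`, the representatives in `C([0,T];H)` of the solutions being uniform limits
(`exists_isBackwardSolution_of_tendsto`). This subspace contains the data of all functions
`t ↦ ψ(t) e` with `ψ` smooth and `e ∈ V`. An element `(v, h)` of its orthogonal complement is thus
a weak solution of the transposed forward problem with zero initial value; `v` vanishes by the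
energy identity for its extension by zero to negative times (`eq_zero_of_forward`), and `h` because
`V` is dense in `H`. So every datum is solvable (`exists_isBackwardSolution`), and neither a
Galerkin scheme nor the embedding of `W(0,T)` into `C([0,T];H)` is needed.

**The star graph.** The space `V` is complete, because the vertex conditions are equations between
functionals that are continuous in the `H¹` norm (`mem_energySubmodule_iff`); it is separable and
dense in `∏ L²(0, lᵢ)`. For almost every `t` the form is bounded by `D_max + ‖u‖` and satisfies
Gårding's inequality with `α = D_min / 2` and `κ = ‖u‖² / (2 D_min) + D_min / 2`
(`garding_form`), so the constant of the estimate is explicit in `T`, `D_min`, `D_max` and `‖u‖`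
(`adjointConst`). -/

noncomputable section

namespace StarGraph

open Filter Topology

/-! ### Weak derivatives on an interval -/

section IntervalCalculus

variable {F : Type*} [NormedAddCommGroup F] [NormedSpace ℝ F]

/-- `g` is the weak derivative on `(a, b)` of the vector valued function `f`. -/
def IsWeakDerivOn (a b : ℝ) (f g : ℝ → F) : Prop :=
  ∀ ψ : ℝ → ℝ, ContDiff ℝ ∞ ψ → HasCompactSupport ψ → tsupport ψ ⊆ Ioo a b →
    ∫ t in Ioo a b, deriv ψ t • f t = -∫ t in Ioo a b, ψ t • g t

theorem integrableOn_smul_of_continuous {a b : ℝ} {ψ : ℝ → ℝ} {f : ℝ → F} (hψ : Continuous ψ)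
    (hf : IntegrableOn f (Ioo a b)) : IntegrableOn (fun t => ψ t • f t) (Ioo a b) := by
  obtain ⟨C, hC⟩ := isCompact_Icc.exists_bound_of_continuousOn (hψ.continuousOn (s := Icc a b))
  refine Integrable.bdd_smul hf C hψ.aestronglyMeasurable ?_
  filter_upwards [ae_restrict_mem measurableSet_Ioo] with t ht
  exact hC t (Ioo_subset_Icc_self ht)

theorem continuousOn_primitive_Icc {a b : ℝ} (hab : a ≤ b) {g : ℝ → F}
    (hg : IntegrableOn g (Ioo a b)) : ContinuousOn (fun t => ∫ s in a..t, g s) (Icc a b) := by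
  have := intervalIntegral.continuousOn_primitive_interval (f := g) (μ := volume) (a := a) (b := b)
    (by rw [uIcc_of_le hab, integrableOn_Icc_iff_integrableOn_Ioo]; exact hg)
  rwa [uIcc_of_le hab] at this

/-- Integration by parts against a primitive: Fubini's theorem on the triangle `a < s ≤ t < b`. -/
theorem integral_deriv_smul_primitive [CompleteSpace F] {a b : ℝ} {g : ℝ → F}
    (hg : IntegrableOn g (Ioo a b)) {ψ : ℝ → ℝ} (hψ : ContDiff ℝ 1 ψ) :
    ∫ t in Ioo a b, deriv ψ t • ∫ s in a..t, g s
      = (ψ b • ∫ t in Ioo a b, g t) - ∫ t in Ioo a b, ψ t • g t := by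
  have hd : Continuous (deriv ψ) := hψ.continuous_deriv le_rfl
  set μ := volume.restrict (Ioo a b) with hμ
  have hdi : IntegrableOn (deriv ψ) (Ioo a b) :=
    (hd.integrableOn_Icc (a := a) (b := b)).mono_set Ioo_subset_Icc_self
  have hψg : IntegrableOn (fun t => ψ t • g t) (Ioo a b) :=
    integrableOn_smul_of_continuous hψ.continuous hg
  have hprod : Integrable
      (Function.uncurry fun t s => (Iic t).indicator (fun s => deriv ψ t • g s) s) (μ.prod μ) := by
    have h1 : Integrable (fun p : ℝ × ℝ => deriv ψ p.1 • g p.2) (μ.prod μ) :=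
      Integrable.smul_prod hdi hg
    have hm : MeasurableSet {p : ℝ × ℝ | p.2 ≤ p.1} :=
      measurableSet_le measurable_snd measurable_fst
    refine (h1.indicator hm).congr (Filter.Eventually.of_forall fun p => ?_)
    rfl
  have hswap := integral_integral_swap hprod
  have hl : ∫ t in Ioo a b, deriv ψ t • ∫ s in a..t, g s
      = ∫ t, ∫ s, (Iic t).indicator (fun s => deriv ψ t • g s) s ∂μ ∂μ := by
    refine setIntegral_congr_fun measurableSet_Ioo fun t ht => ?_
    rw [integral_indicator measurableSet_Iic, integral_smul, hμ,
      Measure.restrict_restrict measurableSet_Iic, intervalIntegral.integral_of_le ht.1.le]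
    congr 3
    ext s
    simp only [mem_Ioc, mem_inter_iff, mem_Iic, mem_Ioo]
    exact ⟨fun h => ⟨h.2, h.1, h.2.trans_lt ht.2⟩, fun h => ⟨h.2.1, h.1⟩⟩
  have hr : ∫ s, ∫ t, (Iic t).indicator (fun s => deriv ψ t • g s) s ∂μ ∂μ
      = ∫ s in Ioo a b, (ψ b • g s - ψ s • g s) := by
    refine setIntegral_congr_fun measurableSet_Ioo fun s hs => ?_
    have e : ∀ t, (Iic t).indicator (fun s => deriv ψ t • g s) s
        = (Ici s).indicator (fun t => deriv ψ t • g s) t := fun t => by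
      simp [indicator_apply]
    simp only [e]
    rw [integral_indicator measurableSet_Ici, integral_smul_const, hμ,
      Measure.restrict_restrict measurableSet_Ici, ← sub_smul]
    congr 1
    have : Ici s ∩ Ioo a b = Ico s b := by
      ext t
      simp only [mem_Ico, mem_inter_iff, mem_Ici, mem_Ioo]
      exact ⟨fun h => ⟨h.1, h.2.2⟩, fun h => ⟨h.1, hs.1.trans_le h.1, h.2⟩⟩
    rw [this, integral_Ico_eq_integral_Ioc, ← intervalIntegral.integral_of_le hs.2.le]
    exact intervalIntegral.integral_deriv_eq_sub
      (fun x _ => (hψ.differentiable one_ne_zero).differentiableAt)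
      (hd.intervalIntegrable _ _)
  have hψb : IntegrableOn (fun s => ψ b • g s) (Ioo a b) := hg.smul _
  rw [hl, hswap, hr, integral_sub hψb hψg, integral_smul]

theorem integral_deriv_of_tsupport_subset {a b : ℝ} {ψ : ℝ → ℝ} (hab : a ≤ b)
    (hψ : ContDiff ℝ 1 ψ) (hs : tsupport ψ ⊆ Ioo a b) : ∫ t in Ioo a b, deriv ψ t = 0 := by
  have hd : Continuous (deriv ψ) := hψ.continuous_deriv le_rfl
  have h0 : ∀ x, x ∉ Ioo a b → ψ x = 0 := fun x hx =>
    image_eq_zero_of_notMem_tsupport fun h => hx (hs h)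
  rw [← integral_Ioc_eq_integral_Ioo, ← intervalIntegral.integral_of_le hab,
    intervalIntegral.integral_deriv_eq_sub
      (fun x _ => (hψ.differentiable one_ne_zero).differentiableAt) (hd.intervalIntegrable _ _),
    h0 a (by simp), h0 b (by simp), sub_self]

theorem isWeakDerivOn_of_primitive [CompleteSpace F] {a b : ℝ} (hab : a ≤ b) {f g : ℝ → F}
    (hg : IntegrableOn g (Ioo a b)) (c : F)
    (hf : ∀ᵐ t ∂volume.restrict (Ioo a b), f t = c + ∫ s in a..t, g s) :
    IsWeakDerivOn a b f g := by
  intro ψ hψ hc hs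
  have hψ1 : ContDiff ℝ 1 ψ := hψ.of_le (by norm_cast)
  have hd : Continuous (deriv ψ) := hψ1.continuous_deriv le_rfl
  have hdi : IntegrableOn (deriv ψ) (Ioo a b) :=
    (hd.integrableOn_Icc (a := a) (b := b)).mono_set Ioo_subset_Icc_self
  have h1 : ∫ t in Ioo a b, deriv ψ t • f t
      = ∫ t in Ioo a b, (deriv ψ t • c + deriv ψ t • ∫ s in a..t, g s) := by
    refine integral_congr_ae ?_
    filter_upwards [hf] with t ht
    rw [ht, smul_add]
  have hcont := continuousOn_primitive_Icc hab hg
  have hdG : IntegrableOn (fun t => deriv ψ t • ∫ s in a..t, g s) (Ioo a b) :=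
    ((hd.continuousOn.smul hcont).integrableOn_Icc).mono_set Ioo_subset_Icc_self
  rw [h1, integral_add (hdi.smul_const c) hdG,
    integral_smul_const, integral_deriv_of_tsupport_subset hab hψ1 hs, zero_smul, zero_add,
    integral_deriv_smul_primitive hg hψ1,
    image_eq_zero_of_notMem_tsupport (f := ψ) (x := b) (fun h => by simpa using hs h),
    zero_smul, zero_sub]

/-- The primitive of a test function of mean zero is a test function. -/
theorem exists_test_primitive {a b : ℝ} {χ : ℝ → ℝ} (hχ : ContDiff ℝ ∞ χ)
    (hs : tsupport χ ⊆ Ioo a b) (hc : HasCompactSupport χ) (h0 : ∫ t in Ioo a b, χ t = 0) :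
    ∃ ψ : ℝ → ℝ, ContDiff ℝ ∞ ψ ∧ HasCompactSupport ψ ∧ tsupport ψ ⊆ Ioo a b ∧ deriv ψ = χ := by
  -- the support lies in a compact interval `[p, q]` inside `(a, b)`
  rcases (tsupport χ).eq_empty_or_nonempty with he | hne
  · refine ⟨0, contDiff_const, HasCompactSupport.zero, by simp [tsupport], ?_⟩
    rw [tsupport_eq_empty_iff] at he
    rw [he]; exact deriv_const' 0
  obtain ⟨p, hp, hpl⟩ := hc.isCompact.exists_isLeast hne
  obtain ⟨q, hq, hqg⟩ := hc.isCompact.exists_isGreatest hne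
  have hpa := hs hp
  have hqb := hs hq
  have hz : ∀ x, x ∉ Icc p q → χ x = 0 := fun x hx =>
    image_eq_zero_of_notMem_tsupport fun h => hx ⟨hpl h, hqg h⟩
  have hd : ∀ x, HasDerivAt (fun t => ∫ s in a..t, χ s) (χ x) x := fun x =>
    intervalIntegral.integral_hasDerivAt_right (hχ.continuous.intervalIntegrable _ _)
      hχ.continuous.stronglyMeasurable.stronglyMeasurableAtFilter hχ.continuous.continuousAt
  have hder : deriv (fun t => ∫ s in a..t, χ s) = χ := funext fun x => (hd x).deriv
  have hsupp : Function.support (fun t => ∫ s in a..t, χ s) ⊆ Icc p q := by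
    intro t ht
    by_contra hn
    apply ht
    rw [mem_Icc, not_and_or, not_le, not_le] at hn
    rcases hn with hn | hn
    · refine (intervalIntegral.integral_congr (g := fun _ => (0 : ℝ)) fun s hs' => ?_).trans
          (by simp)
      exact hz s fun h => by
        have h2 : s ≤ max a t := hs'.2
        rcases le_max_iff.1 h2 with h3 | h3
        · linarith [h.1, hpa.1]
        · linarith [h.1]
    · have hb : ∫ s in a..b, χ s = 0 := by
        rw [intervalIntegral.integral_of_le (hpa.1.trans hpa.2).le,
          integral_Ioc_eq_integral_Ioo, h0]
      have h2 : ∫ s in t..b, χ s = 0 := by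
        refine (intervalIntegral.integral_congr (g := fun _ => (0 : ℝ)) fun s hs' => ?_).trans
          (by simp)
        exact hz s fun h => by
          have h2 : min t b ≤ s := hs'.1
          rcases min_le_iff.1 h2 with h3 | h3
          · linarith [h.2]
          · linarith [h.2, hqb.2]
      have := intervalIntegral.integral_add_adjacent_intervals
        (hχ.continuous.intervalIntegrable (μ := volume) a t) (hχ.continuous.intervalIntegrable t b)
      simp only at *
      linarith
  have hts : tsupport (fun t => ∫ s in a..t, χ s) ⊆ Icc p q := closure_minimal hsupp isClosed_Icc
  refine ⟨_, ?_, HasCompactSupport.of_support_subset_isCompact isCompact_Icc hsupp,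
    hts.trans (fun x hx => ⟨hpa.1.trans_le hx.1, hx.2.trans_lt hqb.2⟩), hder⟩
  rw [contDiff_infty_iff_deriv]
  exact ⟨fun x => (hd x).differentiableAt, by rw [hder]; exact hχ⟩

theorem ae_eq_zero_of_test [CompleteSpace F] {a b : ℝ} {f : ℝ → F} (hf : IntegrableOn f (Ioo a b))
    (h : ∀ ψ : ℝ → ℝ, ContDiff ℝ ∞ ψ → HasCompactSupport ψ → tsupport ψ ⊆ Ioo a b →
      ∫ t in Ioo a b, ψ t • f t = 0) :
    ∀ᵐ t ∂volume.restrict (Ioo a b), f t = 0 := by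
  rw [ae_restrict_iff' measurableSet_Ioo]
  refine isOpen_Ioo.ae_eq_zero_of_integral_contDiff_smul_eq_zero hf.locallyIntegrableOn
    fun ψ h1 h2 h3 => ?_
  rw [← h ψ h1 h2 h3, setIntegral_eq_integral_of_forall_compl_eq_zero]
  intro x hx
  rw [image_eq_zero_of_notMem_tsupport fun h => hx (h3 h), zero_smul]

/-- The du Bois-Reymond lemma: a function with an integrable weak derivative is almost everywhere
a primitive of it. -/
theorem IsWeakDerivOn.exists_ae_eq [CompleteSpace F] {a b : ℝ} (hab : a < b) {f g : ℝ → F}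
    (hf : IntegrableOn f (Ioo a b)) (hg : IntegrableOn g (Ioo a b)) (h : IsWeakDerivOn a b f g) :
    ∃ c, ∀ᵐ t ∂volume.restrict (Ioo a b), f t = c + ∫ s in a..t, g s := by
  set G : ℝ → F := fun t => ∫ s in a..t, g s with hG
  have hcont : ContinuousOn G (Icc a b) := continuousOn_primitive_Icc hab.le hg
  have hGi : IntegrableOn G (Ioo a b) := hcont.integrableOn_Icc.mono_set Ioo_subset_Icc_self
  have hwG : IsWeakDerivOn a b G g := isWeakDerivOn_of_primitive hab.le hg 0 (by simp [hG])
  set k : ℝ → F := fun t => f t - G t with hk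
  have hki : IntegrableOn k (Ioo a b) := hf.sub hGi
  have hk0 : ∀ ψ : ℝ → ℝ, ContDiff ℝ ∞ ψ → HasCompactSupport ψ → tsupport ψ ⊆ Ioo a b →
      ∫ t in Ioo a b, deriv ψ t • k t = 0 := by
    intro ψ h1 h2 h3
    have hd : Continuous (deriv ψ) := h1.continuous_deriv (by simp)
    simp only [hk, smul_sub]
    rw [integral_sub (integrableOn_smul_of_continuous hd hf)
        (integrableOn_smul_of_continuous hd hGi),
      h ψ h1 h2 h3, hwG ψ h1 h2 h3, sub_self]
  -- a bump function of integral one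
  obtain ⟨η, hη, hηc, hηs, hη1⟩ : ∃ η : ℝ → ℝ, ContDiff ℝ ∞ η ∧ HasCompactSupport η ∧
      tsupport η ⊆ Ioo a b ∧ ∫ t in Ioo a b, η t = 1 := by
    let β : ContDiffBump ((a + b) / 2) :=
      ⟨(b - a) / 8, (b - a) / 4, by linarith, by linarith⟩
    have hsub : tsupport (β.normed volume) ⊆ Ioo a b := by
      rw [β.tsupport_normed_eq, Real.closedBall_eq_Icc]
      intro x hx
      have h1 : (a + b) / 2 - (b - a) / 4 ≤ x := hx.1
      have h2 : x ≤ (a + b) / 2 + (b - a) / 4 := hx.2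
      constructor <;> linarith
    refine ⟨β.normed volume, β.contDiff_normed, β.hasCompactSupport_normed, hsub, ?_⟩
    rw [setIntegral_eq_integral_of_forall_compl_eq_zero, β.integral_normed]
    intro x hx
    exact image_eq_zero_of_notMem_tsupport fun h => hx (hsub h)
  refine ⟨∫ t in Ioo a b, η t • k t, ?_⟩
  set c := ∫ t in Ioo a b, η t • k t with hc
  have hconst : IntegrableOn (fun _ : ℝ => c) (Ioo a b) := by
    simp [integrableOn_const_iff]
  have key := ae_eq_zero_of_test (f := fun t => k t - c) (hki.sub hconst) ?_
  · filter_upwards [key] with t ht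
    rw [sub_eq_zero] at ht
    simp only [hk, sub_eq_iff_eq_add] at ht
    exact ht
  · intro ψ h1 h2 h3
    set m := ∫ t in Ioo a b, ψ t with hm
    have hψi : IntegrableOn ψ (Ioo a b) :=
      (h1.continuous.integrable_of_hasCompactSupport h2).integrableOn
    have hηi : IntegrableOn η (Ioo a b) :=
      (hη.continuous.integrable_of_hasCompactSupport hηc).integrableOn
    have hsup : Function.support (fun t => ψ t - m * η t) ⊆ tsupport ψ ∪ tsupport η := by
      intro t ht
      by_contra hn
      rw [mem_union, not_or] at hn
      apply ht
      simp [image_eq_zero_of_notMem_tsupport hn.1, image_eq_zero_of_notMem_tsupport hn.2]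
    obtain ⟨θ, t1, t2, t3, t4⟩ := exists_test_primitive (a := a) (b := b)
      (χ := fun t => ψ t - m * η t) (h1.sub (contDiff_const.mul hη))
      ((closure_minimal hsup ((isClosed_tsupport _).union (isClosed_tsupport _))).trans
        (union_subset h3 hηs))
      (HasCompactSupport.of_support_subset_isCompact (h2.isCompact.union hηc.isCompact) hsup)
      (by rw [integral_sub hψi (hηi.const_mul m), integral_const_mul, hη1, mul_one, hm, sub_self])
    have e := hk0 θ t1 t2 t3
    simp only [t4, sub_smul, mul_smul] at e
    have hηk : IntegrableOn (fun t => m • η t • k t) (Ioo a b) :=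
      (integrableOn_smul_of_continuous hη.continuous hki).smul m
    rw [integral_sub (integrableOn_smul_of_continuous h1.continuous hki) hηk, integral_smul,
      ← hc] at e
    simp only [smul_sub]
    rw [integral_sub (integrableOn_smul_of_continuous h1.continuous hki)
      (hψi.smul_const c), integral_smul_const, ← hm]
    exact e

end IntervalCalculus

/-! ### Differentiating the squared norm in a Hilbert triple -/

section Energy

variable {E H : Type*} [NormedAddCommGroup E] [InnerProductSpace ℝ E]
  [NormedAddCommGroup H] [InnerProductSpace ℝ H]

/-- The embedding `V → H → V*` of a Hilbert triple, `⟨J e, e'⟩ = (j e, j e')_H`. -/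
def gramDual (j : E →L[ℝ] H) : E →L[ℝ] StrongDual ℝ E := (innerSL ℝ).bilinearComp j j

@[simp]
theorem gramDual_apply (j : E →L[ℝ] H) (e e' : E) : gramDual j e e' = inner ℝ (j e) (j e') := rfl

/-- Translation of `L²` functions is continuous. -/
theorem continuous_vadd_Lp {F : Type*} [NormedAddCommGroup F] (f : Lp F 2 (volume : Measure ℝ)) :
    Continuous (fun h : ℝ => DomAddAct.mk h +ᵥ f) := by
  have : Fact ((2 : ℝ≥0∞) ≠ ⊤) := ⟨by simp⟩
  have := continuous_id.vadd (continuous_const (y := f)) (M := ℝᵈᵃᵃ)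
  fun_prop

theorem vadd_Lp_ae_eq {F : Type*} [NormedAddCommGroup F] (h : ℝ)
    (f : Lp F 2 (volume : Measure ℝ)) :
    ∀ᵐ t, (DomAddAct.mk h +ᵥ f : Lp F 2 (volume : Measure ℝ)) t = f (t + h) := by
  filter_upwards [DomAddAct.vadd_Lp_ae_eq (DomAddAct.mk h) f] with t ht
  rw [ht, Equiv.symm_apply_apply, vadd_eq_add, add_comm]

theorem integrable_norm_sq {F : Type*} [NormedAddCommGroup F] {μ : Measure ℝ} {f : ℝ → F}
    (hf : MemLp f 2 μ) : Integrable (fun t => ‖f t‖ ^ 2) μ :=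
  hf.integrable_norm_pow two_ne_zero

/-- The double integral of the pairing of `σ(t + τ)` with `y(t)` over `ℝ × (0, h)` converges. -/
theorem integrable_pairing_translate (σ : Lp (StrongDual ℝ E) 2 (volume : Measure ℝ))
    (y : Lp E 2 (volume : Measure ℝ)) (h : ℝ) :
    Integrable (Function.uncurry fun t τ => σ (t + τ) (y t))
      (volume.prod (volume.restrict (Ioc 0 h))) := by
  have hσm := Lp.stronglyMeasurable σ
  have hym := Lp.stronglyMeasurable y
  have hadd : Measurable fun p : ℝ × ℝ => p.1 + p.2 := by fun_prop
  have hs2 : Integrable (fun p : ℝ × ℝ => ‖σ (p.1 + p.2)‖ ^ 2)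
      (volume.prod (volume.restrict (Ioc 0 h))) := by
    refine (integrable_prod_iff' (f := fun p : ℝ × ℝ => ‖σ (p.1 + p.2)‖ ^ 2)
      ((hσm.comp_measurable hadd).norm.pow 2).aestronglyMeasurable).2 ⟨?_, ?_⟩
    · exact Eventually.of_forall fun τ => (integrable_norm_sq (Lp.memLp σ)).comp_add_right τ
    · have : ∀ τ : ℝ, ∫ t, ‖σ (t + τ)‖ ^ 2 = ∫ t, ‖σ t‖ ^ 2 := fun τ =>
        integral_add_right_eq_self (fun t => ‖σ t‖ ^ 2) τ
      simp only [norm_pow, norm_norm, this]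
      exact integrable_const _
  have hy2 : Integrable (fun p : ℝ × ℝ => ‖y p.1‖ ^ 2)
      (volume.prod (volume.restrict (Ioc 0 h))) :=
    (integrable_norm_sq (Lp.memLp y)).comp_fst _
  refine (hs2.add hy2).mono ?_ (Eventually.of_forall fun p => ?_)
  · exact (isBoundedBilinearMap_apply.continuous.comp_stronglyMeasurable
      ((hσm.comp_measurable hadd).prodMk (hym.comp_measurable measurable_fst))).aestronglyMeasurable
  · simp only [Function.uncurry, Pi.add_apply]
    refine ((σ (p.1 + p.2)).le_opNorm _).trans ?_
    rw [Real.norm_of_nonneg (by positivity)]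
    nlinarith [sq_nonneg (‖σ (p.1 + p.2)‖ - ‖y p.1‖), sq_nonneg ‖σ (p.1 + p.2)‖, sq_nonneg ‖y p.1‖]

/-- The right derivative at `0` of a function whose increments are integrals of a jointly continuous
`G(τ, h)`. -/
theorem tendsto_inv_mul_of_eq_integral {P : ℝ → ℝ} {G : ℝ → ℝ → ℝ} {δ : ℝ} (hδ : 0 < δ)
    (hGc : Continuous (Function.uncurry G))
    (hPG : ∀ h ∈ Ioo 0 δ, P h - P 0 = ∫ τ in (0 : ℝ)..h, G τ h) :
    Tendsto (fun h => h⁻¹ * (P h - P 0)) (𝓝[>] 0) (𝓝 (G 0 0)) := by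
  rw [Metric.tendsto_nhds]
  intro ε hε
  obtain ⟨η, hη, hηG⟩ := Metric.continuous_iff.1 hGc (0, 0) (ε / 2) (by linarith)
  have hm : Ioo 0 (min δ η) ∈ 𝓝[>] (0 : ℝ) := Ioo_mem_nhdsGT (lt_min hδ hη)
  filter_upwards [hm] with h hh
  have hh1 : h ∈ Ioo 0 δ := ⟨hh.1, hh.2.trans_le (min_le_left _ _)⟩
  have hGi : Continuous fun τ => G τ h := hGc.comp (by fun_prop : Continuous fun τ : ℝ => (τ, h))
  have e : (P h - P 0) - h * G 0 0 = ∫ τ in (0 : ℝ)..h, (G τ h - G 0 0) := by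
    rw [intervalIntegral.integral_sub (hGi.intervalIntegrable _ _) (by simp), hPG h hh1]
    simp
  have b : ‖∫ τ in (0 : ℝ)..h, (G τ h - G 0 0)‖ ≤ (ε / 2) * |h - 0| := by
    refine intervalIntegral.norm_integral_le_of_norm_le_const fun τ hτ => ?_
    rw [uIoc_of_le hh.1.le] at hτ
    have hlt : h < η := hh.2.trans_le (min_le_right _ _)
    refine (hηG (τ, h) ?_).le
    rw [Prod.dist_eq]
    simp only [dist_zero_right, Real.norm_eq_abs, abs_of_pos hτ.1, abs_of_pos hh.1]
    exact max_lt (hτ.2.trans_lt hlt) hlt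
  rw [← e, sub_zero, abs_of_pos hh.1, Real.norm_eq_abs] at b
  rw [Real.dist_eq]
  have : h⁻¹ * (P h - P 0) - G 0 0 = h⁻¹ * ((P h - P 0) - h * G 0 0) := by
    field_simp [hh.1.ne']
  rw [this, abs_mul, abs_of_pos (inv_pos.2 hh.1)]
  calc h⁻¹ * |P h - P 0 - h * G 0 0| ≤ h⁻¹ * (ε / 2 * h) :=
        mul_le_mul_of_nonneg_left b (inv_pos.2 hh.1).le
    _ = ε / 2 := by field_simp [hh.1.ne']
    _ < ε := by linarith

/-- Differentiation of `∫ ψ(t - h) N(t) dt` at `h = 0`. -/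
theorem tendsto_inv_mul_integral_translate {ψ N : ℝ → ℝ} (hψ : ContDiff ℝ ∞ ψ)
    (hψc : HasCompactSupport ψ) (hN : Integrable N) :
    Tendsto (fun h => h⁻¹ * ((∫ t, ψ (t - h) * N t) - ∫ t, ψ (t - 0) * N t)) (𝓝[>] 0)
      (𝓝 (∫ t, -deriv ψ t * N t)) := by
  obtain ⟨C, hC⟩ := hψc.exists_bound_of_continuous hψ.continuous
  have hcont := hψ.continuous
  have hψN : ∀ h : ℝ, Integrable (fun t => ψ (t - h) * N t) volume := fun h =>
    hN.bdd_mul (c := C) (by fun_prop) (Eventually.of_forall fun t => hC _)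
  obtain ⟨L, hL⟩ := hψc.deriv.exists_bound_of_continuous (hψ.continuous_deriv (by simp))
  have hlip : LipschitzWith (Real.nnabs L) ψ := by
    refine lipschitzWith_of_nnnorm_deriv_le (hψ.differentiable (by simp)) fun x => ?_
    rw [← NNReal.coe_le_coe]
    simpa using (hL x).trans (le_abs_self L)
  have hder := hasDerivAt_integral_of_dominated_loc_of_lip (μ := (volume : Measure ℝ)) (𝕜 := ℝ)
    (F := fun h t => ψ (t - h) * N t) (x₀ := 0) (s := univ)
    (bound := fun t => |L| * ‖N t‖) (F' := fun t => -deriv ψ t * N t)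
    univ_mem (Eventually.of_forall fun h => (hψN h).aestronglyMeasurable) (hψN 0)
    (((hψ.continuous_deriv (by simp)).neg.aestronglyMeasurable).mul hN.aestronglyMeasurable)
    (Eventually.of_forall fun t => by
      refine LipschitzOnWith.of_dist_le_mul fun x _ y _ => ?_
      rw [Real.dist_eq, ← sub_mul, abs_mul, Real.coe_nnabs, abs_mul, abs_abs,
        Real.norm_eq_abs, abs_abs]
      have h1 := hlip.dist_le_mul (t - x) (t - y)
      rw [Real.dist_eq, Real.dist_eq, Real.coe_nnabs] at h1
      have h2 : |t - x - (t - y)| = |x - y| := by rw [sub_sub_sub_cancel_left, abs_sub_comm]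
      rw [h2] at h1
      rw [Real.dist_eq]
      calc _ ≤ |L| * |x - y| * |N t| := mul_le_mul_of_nonneg_right h1 (abs_nonneg _)
        _ = _ := by ring)
    (hN.norm.const_mul _)
    (Eventually.of_forall fun t => by
      have h1 : HasDerivAt ψ (deriv ψ t) (t - 0) := by
        rw [sub_zero]
        exact (hψ.differentiable (by simp) t).hasDerivAt
      have h2 : HasDerivAt (fun h : ℝ => t - h) (-1) 0 := by
        simpa using (hasDerivAt_id (0 : ℝ)).const_sub t
      simpa using (h1.comp 0 h2).mul_const (N t))
  have := (hasDerivAt_iff_tendsto_slope.1 hder.2).mono_left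
    (nhdsWithin_mono 0 (fun x hx => (ne_of_gt hx : x ≠ 0)))
  refine this.congr fun h => ?_
  simp [slope_def_field, div_eq_inv_mul]

theorem exists_extension_Lp {F : Type*} [NormedAddCommGroup F] {a b : ℝ} {f : ℝ → F}
    (hf : MemLp f 2 (volume.restrict (Ioo a b))) :
    ∃ f₀ : Lp F 2 (volume : Measure ℝ), ∀ᵐ t, t ∈ Ioo a b → f₀ t = f t := by
  have hf' : MemLp ((Ioo a b).indicator f) 2 volume :=
    (memLp_indicator_iff_restrict measurableSet_Ioo).2 hf
  refine ⟨hf'.toLp, ?_⟩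
  filter_upwards [hf'.coeFn_toLp] with t ht h
  rw [ht, indicator_of_mem h]

/-- Multiplication by a bounded function is a bounded operator on `L²`. -/
theorem exists_mulOperator {F : Type*} [NormedAddCommGroup F] [NormedSpace ℝ F] {μ : Measure ℝ}
    {ψ : ℝ → ℝ} (hψ : AEStronglyMeasurable ψ μ) {C : ℝ} (hC : ∀ᵐ t ∂μ, ‖ψ t‖ ≤ C) :
    ∃ M : Lp F 2 μ →L[ℝ] Lp F 2 μ, ∀ y, ∀ᵐ t ∂μ, M y t = ψ t • y t := by
  have hψt : MemLp ψ ∞ μ := memLp_top_of_bound hψ C hC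
  refine ⟨(ContinuousLinearMap.lsmul ℝ ℝ).holderL μ ∞ 2 2 (hψt.toLp), fun y => ?_⟩
  filter_upwards [(ContinuousLinearMap.lsmul ℝ ℝ).coeFn_holder (r := 2) (hψt.toLp) y,
    hψt.coeFn_toLp] with t h1 h2
  change (ContinuousLinearMap.lsmul ℝ ℝ).holder 2 (hψt.toLp) y t = _
  rw [h1, h2]; rfl

/-- By the continuity of translations in `L²`, the pairing of a translate of `σ` with `Y h` depends
jointly continuously on the shift and on `h`. -/
theorem continuous_pairing_translate (σ : Lp (StrongDual ℝ E) 2 (volume : Measure ℝ))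
    {Y : ℝ → Lp E 2 (volume : Measure ℝ)} (hY : Continuous Y) :
    Continuous (Function.uncurry fun τ h : ℝ => ∫ t, σ (t + τ) (Y h t)) := by
  have hG : Continuous fun p : ℝ × ℝ =>
      ((ContinuousLinearMap.id ℝ (StrongDual ℝ E)).lpPairing (volume : Measure ℝ) 2 2)
        (DomAddAct.mk p.1 +ᵥ σ) (Y p.2) :=
    ((ContinuousLinearMap.continuous _).comp
      ((continuous_vadd_Lp σ).comp continuous_fst)).clm_apply (hY.comp continuous_snd)
  refine hG.congr fun p => ?_
  rw [ContinuousLinearMap.lpPairing_eq_integral]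
  refine integral_congr_ae ?_
  filter_upwards [vadd_Lp_ae_eq p.1 σ] with t ht
  rw [ht]; rfl

/-- The increment of `‖f‖²` over a time step `h`, tested with `ψ`, as a pairing of translates of `σ`
with `y(t) = ψ(t) (f(t + h) + f(t))`. -/
theorem integral_sub_translate_eq (j : E →L[ℝ] H) {a b : ℝ} {f₀ : Lp E 2 (volume : Measure ℝ)}
    {σ₀ : Lp (StrongDual ℝ E) 2 (volume : Measure ℝ)} {σ : ℝ → StrongDual ℝ E}
    (hσi : IntegrableOn σ (Ioo a b)) (hσ₀e : ∀ᵐ t, t ∈ Ioo a b → σ₀ t = σ t)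
    {c : StrongDual ℝ E}
    (hc' : ∀ᵐ t, t ∈ Ioo a b → gramDual j (f₀ t) = c + ∫ s in a..t, σ s) {ψ : ℝ → ℝ}
    (hψN : ∀ h : ℝ, Integrable (fun t => ψ (t - h) * ‖j (f₀ t)‖ ^ 2) volume)
    (hψs : tsupport ψ ⊆ Ioo a b) {h : ℝ} (hh : 0 < h)
    (hhK : ∀ t ∈ tsupport ψ, t + h ∈ Ioo a b) {y : Lp E 2 (volume : Measure ℝ)}
    (hy : ∀ᵐ t, y t = ψ t • (f₀ (t + h) + f₀ t)) :
    (∫ t, ψ (t - h) * ‖j (f₀ t)‖ ^ 2) - ∫ t, ψ (t - 0) * ‖j (f₀ t)‖ ^ 2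
      = ∫ τ in (0 : ℝ)..h, ∫ t, σ₀ (t + τ) (y t) := by
  have e1 : ∫ t, ψ (t - h) * ‖j (f₀ t)‖ ^ 2 = ∫ t, ψ t * ‖j (f₀ (t + h))‖ ^ 2 := by
    rw [← integral_add_right_eq_self _ h]
    simp only [add_sub_cancel_right]
  have i1 : Integrable (fun t => ψ t * ‖j (f₀ (t + h))‖ ^ 2) volume := by
    simpa using (hψN h).comp_add_right h
  have i0 : Integrable (fun t => ψ t * ‖j (f₀ t)‖ ^ 2) volume := by
    simpa using hψN 0
  have e2 : (∫ t, ψ (t - h) * ‖j (f₀ t)‖ ^ 2) - ∫ t, ψ (t - 0) * ‖j (f₀ t)‖ ^ 2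
      = ∫ t, ∫ τ in Ioc 0 h, σ₀ (t + τ) (y t) := by
    rw [e1]
    simp only [sub_zero]
    rw [← integral_sub i1 i0]
    have hc'' : ∀ᵐ t, t + h ∈ Ioo a b →
        gramDual j (f₀ (t + h)) = c + ∫ s in a..(t + h), σ s :=
      (measurePreserving_add_right volume h).quasiMeasurePreserving.ae hc'
    refine integral_congr_ae ?_
    filter_upwards [hc', hc'', hy] with t h1 h2 h3
    rw [h3]
    by_cases ht : t ∈ tsupport ψ
    · have ht1 : t ∈ Ioo a b := hψs ht
      have ht2 : t + h ∈ Ioo a b := hhK t ht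
      have hint : ∀ x ∈ Ioo a b, IntervalIntegrable σ volume a x := fun x hx =>
        (intervalIntegrable_iff_integrableOn_Ioo_of_le hx.1.le).2
          (hσi.mono_set (Ioo_subset_Ioo_right hx.2.le))
      have d : gramDual j (f₀ (t + h)) - gramDual j (f₀ t) = ∫ τ in Ioc 0 h, σ₀ (t + τ) := by
        rw [h1 ht1, h2 ht2, add_sub_add_left_eq_sub,
          intervalIntegral.integral_interval_sub_left (hint _ ht2) (hint _ ht1),
          ← intervalIntegral.integral_of_le hh.le,
          intervalIntegral.integral_comp_add_left (fun s => σ₀ s) t, add_zero]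
        refine intervalIntegral.integral_congr_ae ?_
        filter_upwards [hσ₀e] with s hs hs'
        rw [uIoc_of_le (by linarith [hh])] at hs'
        exact (hs ⟨ht1.1.trans hs'.1, hs'.2.trans_lt ht2.2⟩).symm
      have hint2 : Integrable (fun τ => σ₀ (t + τ)) (volume.restrict (Ioc 0 h)) :=
        ((((Lp.memLp σ₀).comp_measurePreserving
          (measurePreserving_add_left volume t)).restrict _).integrable one_le_two)
      rw [← ContinuousLinearMap.integral_apply hint2, ← d, map_smul, smul_eq_mul]
      simp only [map_add, sub_apply, gramDual_apply, real_inner_self_eq_norm_sq]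
      rw [real_inner_comm (j (f₀ t)) (j (f₀ (t + h)))]
      ring
    · simp [image_eq_zero_of_notMem_tsupport ht]
  rw [e2, integral_integral_swap (integrable_pairing_translate σ₀ y h),
    intervalIntegral.integral_of_le hh.le]

/-- Product rule for the square of the `H`-norm of an `L²(a,b;V)` function with weak derivative in
`L²(a,b;V*)`. The difference quotient of `‖f‖²` is, by symmetry of the embedding `V → V*`, the
pairing of the Steklov average of `σ` with `f(t + h) + f(t)`, and translations are continuous in
`L²`. -/
theorem isWeakDerivOn_norm_sq (j : E →L[ℝ] H) {a b : ℝ} (hab : a < b) {f : ℝ → E}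
    {σ : ℝ → StrongDual ℝ E} (hf : MemLp f 2 (volume.restrict (Ioo a b)))
    (hσ : MemLp σ 2 (volume.restrict (Ioo a b)))
    (hw : IsWeakDerivOn a b (fun t => gramDual j (f t)) σ) :
    IsWeakDerivOn a b (fun t => ‖j (f t)‖ ^ 2) (fun t => 2 * σ t (f t)) := by
  intro ψ hψ hψc hψs
  have hσi : IntegrableOn σ (Ioo a b) := hσ.integrable one_le_two
  obtain ⟨c, hc⟩ :=
    hw.exists_ae_eq hab ((gramDual j).integrable_comp (hf.integrable one_le_two)) hσi
  obtain ⟨f₀, hf₀e⟩ := exists_extension_Lp hf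
  obtain ⟨σ₀, hσ₀e⟩ := exists_extension_Lp hσ
  have hψz : ∀ t, t ∉ Ioo a b → ψ t = 0 := fun t ht =>
    image_eq_zero_of_notMem_tsupport fun h => ht (hψs h)
  have hdz : ∀ t, t ∉ Ioo a b → deriv ψ t = 0 := fun t ht =>
    image_eq_zero_of_notMem_tsupport fun h => ht (hψs (tsupport_deriv_subset h))
  have hcont := hψ.continuous
  obtain ⟨C, hC⟩ := hψc.exists_bound_of_continuous hcont
  obtain ⟨M, hM⟩ := exists_mulOperator (F := E) (μ := volume) hcont.aestronglyMeasurable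
    (Eventually.of_forall hC)
  obtain ⟨Y, hYc, hYe⟩ : ∃ Y : ℝ → Lp E 2 (volume : Measure ℝ), Continuous Y ∧
      ∀ h, ∀ᵐ t, Y h t = ψ t • (f₀ (t + h) + f₀ t) := by
    refine ⟨fun h => M ((DomAddAct.mk h +ᵥ f₀) + f₀),
      M.continuous.comp ((continuous_vadd_Lp f₀).add continuous_const), fun h => ?_⟩
    filter_upwards [hM ((DomAddAct.mk h +ᵥ f₀) + f₀), vadd_Lp_ae_eq h f₀,
      Lp.coeFn_add (DomAddAct.mk h +ᵥ f₀) f₀] with t h1 h2 h3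
    rw [h1, h3, Pi.add_apply, h2]
  obtain ⟨δ, hδ, hδK⟩ := hψc.isCompact.exists_cthickening_subset_open isOpen_Ioo hψs
  have hN : Integrable (fun t => ‖j (f₀ t)‖ ^ 2) volume :=
    integrable_norm_sq (j.comp_memLp' (Lp.memLp f₀))
  have hψN : ∀ h : ℝ, Integrable (fun t => ψ (t - h) * ‖j (f₀ t)‖ ^ 2) volume := fun h =>
    hN.bdd_mul (c := C) (by fun_prop) (Eventually.of_forall fun t => hC _)
  have hc' : ∀ᵐ t, t ∈ Ioo a b → gramDual j (f₀ t) = c + ∫ s in a..t, σ s := by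
    filter_upwards [(ae_restrict_iff' measurableSet_Ioo).1 hc, hf₀e] with t h1 h2 h3
    rw [h2 h3, h1 h3]
  have hlim1 := tendsto_inv_mul_of_eq_integral hδ (continuous_pairing_translate σ₀ hYc)
    (P := fun h => ∫ t, ψ (t - h) * ‖j (f₀ t)‖ ^ 2) fun h hh =>
      integral_sub_translate_eq j hσi hσ₀e hc' hψN hψs hh.1
        (fun t ht => hδK (Metric.mem_cthickening_of_dist_le _ t _ _ ht (by
          simp [abs_of_pos hh.1, hh.2.le]))) (hYe h)
  have huniq := tendsto_nhds_unique hlim1 (tendsto_inv_mul_integral_translate hψ hψc hN)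
  have hl : ∫ t in Ioo a b, deriv ψ t • ‖j (f t)‖ ^ 2 = ∫ t, deriv ψ t * ‖j (f₀ t)‖ ^ 2 := by
    rw [← setIntegral_eq_integral_of_forall_compl_eq_zero (s := Ioo a b)
      (f := fun t => deriv ψ t * ‖j (f₀ t)‖ ^ 2) (fun t ht => by rw [hdz t ht, zero_mul])]
    refine integral_congr_ae ((ae_restrict_iff' measurableSet_Ioo).2 ?_)
    filter_upwards [hf₀e] with t h1 h2
    rw [h1 h2, smul_eq_mul]
  have hr : ∫ t in Ioo a b, ψ t • (2 * σ t (f t)) = ∫ t, σ₀ (t + 0) (Y 0 t) := by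
    trans ∫ t, ψ t • (2 * σ₀ t (f₀ t))
    · rw [← setIntegral_eq_integral_of_forall_compl_eq_zero (s := Ioo a b)
        (f := fun t => ψ t • (2 * σ₀ t (f₀ t))) (fun t ht => by rw [hψz t ht, zero_smul])]
      refine integral_congr_ae ((ae_restrict_iff' measurableSet_Ioo).2 ?_)
      filter_upwards [hf₀e, hσ₀e] with t h1 h2 h3
      rw [h1 h3, h2 h3]
    · refine integral_congr_ae ?_
      filter_upwards [hYe 0] with t ht
      rw [ht, add_zero, map_smul, map_add, two_mul]
  rw [hl, hr, huniq, ← integral_neg]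
  simp

end Energy

/-! ### The weighted energy identity -/

section EnergyIdentity

variable {E H : Type*} [NormedAddCommGroup E] [InnerProductSpace ℝ E]
  [NormedAddCommGroup H] [InnerProductSpace ℝ H]

/-- Leibniz rule for the product with a smooth scalar function. -/
theorem IsWeakDerivOn.smooth_smul {F : Type*} [NormedAddCommGroup F] [NormedSpace ℝ F] {a b : ℝ}
    {f g : ℝ → F} (h : IsWeakDerivOn a b f g) (hf : IntegrableOn f (Ioo a b))
    (hg : IntegrableOn g (Ioo a b)) {w : ℝ → ℝ} (hw : ContDiff ℝ ∞ w) :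
    IsWeakDerivOn a b (fun t => w t • f t) (fun t => w t • g t + deriv w t • f t) := by
  intro ψ hψ hψc hψs
  have hdw : Continuous (deriv w) := hw.continuous_deriv (by simp)
  have hdψ : Continuous (deriv ψ) := hψ.continuous_deriv (by simp)
  have hdiff : ∀ t, deriv (fun s => ψ s * w s) t = deriv ψ t * w t + ψ t * deriv w t := fun t =>
    deriv_fun_mul (hψ.differentiable (by simp) t) (hw.differentiable (by simp) t)
  have key := h (fun t => ψ t * w t) (hψ.mul hw) hψc.mul_right
    ((closure_mono (Function.support_mul_subset_left ψ w)).trans hψs)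
  simp only [hdiff, add_smul] at key
  have i1 : IntegrableOn (fun t => (deriv ψ t * w t) • f t) (Ioo a b) :=
    integrableOn_smul_of_continuous (hdψ.mul hw.continuous) hf
  have i2 : IntegrableOn (fun t => (ψ t * deriv w t) • f t) (Ioo a b) :=
    integrableOn_smul_of_continuous (hψ.continuous.mul hdw) hf
  have i3 : IntegrableOn (fun t => (ψ t * w t) • g t) (Ioo a b) :=
    integrableOn_smul_of_continuous (hψ.continuous.mul hw.continuous) hg
  rw [integral_add i1 i2] at key
  simp only [smul_add, smul_smul]
  rw [integral_add i3 i2, ← sub_eq_zero]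
  rw [← sub_eq_zero] at key
  rw [← key]
  abel

theorem integrable_pairing {μ : Measure ℝ} {f : ℝ → E} {σ : ℝ → StrongDual ℝ E}
    (hf : MemLp f 2 μ) (hσ : MemLp σ 2 μ) : Integrable (fun t => σ t (f t)) μ :=
  memLp_one_iff_integrable.1 ((ContinuousLinearMap.id ℝ (StrongDual ℝ E)).memLp_of_bilin 1 hσ hf)

/-- The integrand of the energy identity with weight `e^{2κt}`. -/
def energyRate (j : E →L[ℝ] H) (κ : ℝ) (f : ℝ → E) (σ : ℝ → StrongDual ℝ E) (t : ℝ) : ℝ :=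
  Real.exp (2 * κ * t) * (2 * σ t (f t) + 2 * κ * ‖j (f t)‖ ^ 2)

theorem integrableOn_energyRate (j : E →L[ℝ] H) (κ : ℝ) {a b : ℝ} {f : ℝ → E}
    {σ : ℝ → StrongDual ℝ E} (hf : MemLp f 2 (volume.restrict (Ioo a b)))
    (hσ : MemLp σ 2 (volume.restrict (Ioo a b))) :
    IntegrableOn (energyRate j κ f σ) (Ioo a b) :=
  integrableOn_smul_of_continuous (by fun_prop)
    (((integrable_pairing hf hσ).const_mul 2).add
      ((integrable_norm_sq (j.comp_memLp' hf)).const_mul (2 * κ)))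

/-- The energy identity with weight `e^{2κt}`, almost everywhere. -/
theorem exists_energy_ae_eq (j : E →L[ℝ] H) (κ : ℝ) {a b : ℝ} (hab : a < b) {f : ℝ → E}
    {σ : ℝ → StrongDual ℝ E} (hf : MemLp f 2 (volume.restrict (Ioo a b)))
    (hσ : MemLp σ 2 (volume.restrict (Ioo a b)))
    (hw : IsWeakDerivOn a b (fun t => gramDual j (f t)) σ) :
    ∃ c, ∀ᵐ t ∂volume.restrict (Ioo a b),
      Real.exp (2 * κ * t) * ‖j (f t)‖ ^ 2 = c + ∫ s in a..t, energyRate j κ f σ s := by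
  have hN := integrable_norm_sq (j.comp_memLp' hf)
  have hP := (integrable_pairing hf hσ).const_mul 2
  have hsm : ContDiff ℝ ∞ fun t : ℝ => Real.exp (2 * κ * t) := by fun_prop
  have hd : ∀ t, deriv (fun t : ℝ => Real.exp (2 * κ * t)) t = Real.exp (2 * κ * t) * (2 * κ) :=
    fun t => by
      have : HasDerivAt (fun t : ℝ => Real.exp (2 * κ * t)) (Real.exp (2 * κ * t) * (2 * κ)) t := by
        simpa using ((hasDerivAt_id t).const_mul (2 * κ)).exp
      exact this.deriv
  have h1 := (isWeakDerivOn_norm_sq j hab hf hσ hw).smooth_smul hN hP hsm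
  have e : (fun t => Real.exp (2 * κ * t) • (2 * σ t (f t))
      + deriv (fun t : ℝ => Real.exp (2 * κ * t)) t • ‖j (f t)‖ ^ 2) = energyRate j κ f σ := by
    funext t
    rw [hd, energyRate, smul_eq_mul, smul_eq_mul]
    ring
  rw [e] at h1
  exact h1.exists_ae_eq hab (integrableOn_smul_of_continuous hsm.continuous hN)
    (integrableOn_energyRate j κ hf hσ)

/-- Two continuous functions on `[a, b]` that agree almost everywhere agree. -/
theorem eqOn_Icc_of_ae {X : Type*} [TopologicalSpace X] [T2Space X] {a b : ℝ} (hab : a < b)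
    {f g : ℝ → X} (hf : ContinuousOn f (Icc a b)) (hg : ContinuousOn g (Icc a b))
    (h : ∀ᵐ t ∂volume.restrict (Ioo a b), f t = g t) : EqOn f g (Icc a b) := by
  refine Measure.eqOn_Icc_of_ae_eq (μ := volume) hab.ne ?_ hf hg
  rw [Measure.restrict_congr_set Ioo_ae_eq_Icc.symm]
  exact h

/-- The energy identity with weight `e^{2κt}` for the continuous representative `R`. -/
theorem energy_identity (j : E →L[ℝ] H) (κ : ℝ) {T : ℝ} (hT : 0 < T) {f : ℝ → E}
    {σ : ℝ → StrongDual ℝ E} (hf : MemLp f 2 (intervalMeasure T))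
    (hσ : MemLp σ 2 (intervalMeasure T))
    (hw : IsWeakDerivOn 0 T (fun t => gramDual j (f t)) σ) {R : ℝ → H}
    (hR : ContinuousOn R (Icc 0 T)) (hRf : ∀ᵐ t ∂intervalMeasure T, R t = j (f t))
    {s t : ℝ} (hs : s ∈ Icc 0 T) (ht : t ∈ Icc 0 T) :
    Real.exp (2 * κ * t) * ‖R t‖ ^ 2 - Real.exp (2 * κ * s) * ‖R s‖ ^ 2
      = ∫ τ in s..t, energyRate j κ f σ τ := by
  obtain ⟨c, hc⟩ := exists_energy_ae_eq j κ hT hf hσ hw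
  have hi := integrableOn_energyRate j κ hf hσ
  have heq : EqOn (fun t => Real.exp (2 * κ * t) * ‖R t‖ ^ 2)
      (fun t => c + ∫ s in (0 : ℝ)..t, energyRate j κ f σ s) (Icc 0 T) := by
    refine eqOn_Icc_of_ae hT ?_ (continuousOn_const.add (continuousOn_primitive_Icc hT.le hi)) ?_
    · exact (Continuous.continuousOn (by fun_prop)).mul (hR.norm.pow 2)
    · filter_upwards [hc, hRf] with t h1 h2
      rw [h2, h1]
  have hint : ∀ x ∈ Icc 0 T, IntervalIntegrable (energyRate j κ f σ) volume 0 x := fun x hx =>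
    (intervalIntegrable_iff_integrableOn_Ioo_of_le hx.1).2 (hi.mono_set (Ioo_subset_Ioo_right hx.2))
  have h1 := heq hs
  have h2 := heq ht
  simp only at h1 h2
  rw [h1, h2, add_sub_add_left_eq_sub,
    intervalIntegral.integral_interval_sub_left (hint _ ht) (hint _ hs)]

/-- The scalar definition of the weak time derivative, tested with each `φ ∈ V`, agrees with the one
by Bochner integrals in `V*`. -/
theorem hasWeakTimeDeriv_iff (j : E →L[ℝ] H) {T : ℝ} (ρ : Lp E 2 (intervalMeasure T))
    (σ : Lp (StrongDual ℝ E) 2 (intervalMeasure T)) :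
    HasWeakTimeDeriv j ρ σ ↔ IsWeakDerivOn 0 T (fun t => gramDual j (ρ t)) σ := by
  have hJ : Integrable (fun t => gramDual j (ρ t)) (intervalMeasure T) :=
    (gramDual j).integrable_comp ((Lp.memLp ρ).integrable one_le_two)
  have hσ : Integrable σ (intervalMeasure T) := (Lp.memLp σ).integrable one_le_two
  have e : ∀ ψ : ℝ → ℝ, ContDiff ℝ ∞ ψ → ∀ φ,
      ((∫ t in Ioo 0 T, deriv ψ t • gramDual j (ρ t)) φ
        = ∫ t, inner ℝ (j (ρ t)) (j φ) * deriv ψ t ∂intervalMeasure T) ∧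
      (-∫ t in Ioo 0 T, ψ t • σ t) φ = -∫ t, σ t φ * ψ t ∂intervalMeasure T := fun ψ h1 φ => by
    have hd : Continuous (deriv ψ) := h1.continuous_deriv (by simp)
    rw [neg_apply, ContinuousLinearMap.integral_apply (integrableOn_smul_of_continuous hd hJ),
      ContinuousLinearMap.integral_apply (integrableOn_smul_of_continuous h1.continuous hσ)]
    simp only [smul_apply, gramDual_apply, smul_eq_mul, mul_comm, true_and]
  constructor
  · intro h ψ h1 h2 h3
    ext φ
    rw [(e ψ h1 φ).1, (e ψ h1 φ).2, h φ ψ ⟨h1, h2, h3⟩]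
  · intro h φ ψ hψ
    rw [← (e ψ hψ.smooth φ).1, ← (e ψ hψ.smooth φ).2, h ψ hψ.smooth hψ.compact hψ.supp]

theorem norm_Lp_sq {F : Type*} [NormedAddCommGroup F] {μ : Measure ℝ} (f : Lp F 2 μ) :
    ‖f‖ ^ 2 = ∫ t, ‖f t‖ ^ 2 ∂μ := by
  rw [Lp.norm_def, MemLp.eLpNorm_eq_integral_rpow_norm two_ne_zero ENNReal.ofNat_ne_top
    (Lp.memLp f)]
  have h0 : 0 ≤ ∫ t, ‖f t‖ ^ 2 ∂μ := integral_nonneg fun t => by positivity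
  simp only [ENNReal.toReal_ofNat, Real.rpow_two]
  rw [ENNReal.toReal_ofReal (by positivity), ← Real.rpow_two, ← Real.rpow_mul h0]
  norm_num

end EnergyIdentity

/-! ### Energy estimates under a Gårding inequality -/

section Estimates

variable {E H : Type*} [NormedAddCommGroup E] [InnerProductSpace ℝ E]
  [NormedAddCommGroup H] [InnerProductSpace ℝ H]

/-- Gårding's inequality on `(0, T)` for the bilinear forms `a t`, seen as operators `V → V*`. -/
def IsGarding (j : E →L[ℝ] H) (T α κ : ℝ) (a : ℝ → E →L[ℝ] StrongDual ℝ E) : Prop :=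
  ∀ᵐ t ∂intervalMeasure T, ∀ e, α * ‖e‖ ^ 2 ≤ a t e e + κ * ‖j e‖ ^ 2

variable {j : E →L[ℝ] H} {T α κ : ℝ} {a : ℝ → E →L[ℝ] StrongDual ℝ E}

/-- Energy estimate for the forward problem `σ + a r = 0`. -/
theorem forward_estimate (hT : 0 < T) (hκ : 0 ≤ κ) (hα : 0 ≤ α) (ha : IsGarding j T α κ a)
    (w : EvolutionSpace j T)
    (heq : ∀ᵐ t ∂intervalMeasure T, w.1.snd t = -a t (w.1.fst t)) {R : ℝ → H}
    (hR : ContinuousOn R (Icc 0 T)) (hRf : ∀ᵐ t ∂intervalMeasure T, R t = j (w.1.fst t)) :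
    ‖R T‖ ^ 2 + 2 * α * ‖w.1.fst‖ ^ 2 ≤ Real.exp (2 * κ * T) * ‖R 0‖ ^ 2 := by
  have hw := (hasWeakTimeDeriv_iff j w.1.fst w.1.snd).1 w.2
  have hf := Lp.memLp w.1.fst
  have hσ := Lp.memLp w.1.snd
  have hid := energy_identity j (-κ) hT hf hσ hw hR hRf (left_mem_Icc.2 hT.le)
    (right_mem_Icc.2 hT.le)
  rw [intervalIntegral.integral_of_le hT.le, integral_Ioc_eq_integral_Ioo] at hid
  have hle : ∫ t in Ioo 0 T, energyRate j (-κ) w.1.fst w.1.snd t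
      ≤ ∫ t in Ioo 0 T, -(Real.exp (-(2 * κ * T)) * (2 * α)) * ‖w.1.fst t‖ ^ 2 := by
    refine integral_mono_ae (integrableOn_energyRate j _ hf hσ)
      ((integrable_norm_sq hf).const_mul _) ?_
    filter_upwards [heq, ha, ae_restrict_mem measurableSet_Ioo] with t h1 h2 h3
    have h4 := h2 (w.1.fst t)
    have hexp : Real.exp (-(2 * κ * T)) ≤ Real.exp (2 * (-κ) * t) :=
      Real.exp_le_exp.2 (by nlinarith [h3.2])
    simp only [energyRate, h1, neg_apply]
    have h5 : Real.exp (-(2 * κ * T)) * (α * ‖w.1.fst t‖ ^ 2)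
        ≤ Real.exp (2 * (-κ) * t) * (α * ‖w.1.fst t‖ ^ 2) :=
      mul_le_mul_of_nonneg_right hexp (by positivity)
    have h6 := mul_le_mul_of_nonneg_left h4 (Real.exp_pos (2 * (-κ) * t)).le
    nlinarith
  rw [integral_const_mul, ← norm_Lp_sq] at hle
  rw [← hid] at hle
  have hinv : Real.exp (2 * κ * T) * Real.exp (-(2 * κ * T)) = 1 := by
    rw [← Real.exp_add]; simp
  have hm := mul_le_mul_of_nonneg_left hle (Real.exp_pos (2 * κ * T)).le
  have e1 : 2 * -κ * T = -(2 * κ * T) := by ring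
  rw [e1, mul_zero, Real.exp_zero, one_mul] at hm
  have e2 : Real.exp (2 * κ * T) * (Real.exp (-(2 * κ * T)) * ‖R T‖ ^ 2 - ‖R 0‖ ^ 2)
      = ‖R T‖ ^ 2 - Real.exp (2 * κ * T) * ‖R 0‖ ^ 2 := by
    rw [mul_sub, ← mul_assoc, hinv, one_mul]
  have e3 : Real.exp (2 * κ * T) * (-(Real.exp (-(2 * κ * T)) * (2 * α)) * ‖w.1.fst‖ ^ 2)
      = -(2 * α * ‖w.1.fst‖ ^ 2) := by
    linear_combination (-(2 * α * ‖w.1.fst‖ ^ 2)) * hinv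
  rw [e2, e3] at hm
  linarith

/-- Energy estimate for the backward problem `-σ + a q = F`, on `[t, T]`. -/
theorem backward_estimate (hT : 0 < T) (hκ : 0 ≤ κ) (hα : 0 < α) (ha : IsGarding j T α κ a)
    (w : EvolutionSpace j T) (F : Lp (StrongDual ℝ E) 2 (intervalMeasure T))
    (heq : ∀ᵐ t ∂intervalMeasure T, -w.1.snd t + a t (w.1.fst t) = F t) {Q : ℝ → H}
    (hQ : ContinuousOn Q (Icc 0 T)) (hQf : ∀ᵐ t ∂intervalMeasure T, Q t = j (w.1.fst t))
    {t : ℝ} (ht : t ∈ Icc 0 T) :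
    ‖Q t‖ ^ 2 + α * (∫ s in t..T, ‖w.1.fst s‖ ^ 2)
      ≤ Real.exp (2 * κ * T) * (‖Q T‖ ^ 2 + α⁻¹ * ‖F‖ ^ 2) := by
  have hw := (hasWeakTimeDeriv_iff j w.1.fst w.1.snd).1 w.2
  have hf := Lp.memLp w.1.fst
  have hσ := Lp.memLp w.1.snd
  have hF := Lp.memLp F
  have hid := energy_identity j κ hT hf hσ hw hQ hQf ht (right_mem_Icc.2 hT.le)
  have hsub : Ioo t T ⊆ Ioo 0 T := Ioo_subset_Ioo_left ht.1
  have hi1 : IntegrableOn (fun s => ‖w.1.fst s‖ ^ 2) (Ioo t T) :=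
    IntegrableOn.mono_set (integrable_norm_sq hf) hsub
  have hi2 : IntegrableOn (fun s => ‖F s‖ ^ 2) (Ioo t T) :=
    IntegrableOn.mono_set (integrable_norm_sq hF) hsub
  rw [intervalIntegral.integral_of_le ht.2, integral_Ioc_eq_integral_Ioo] at hid ⊢
  have hle : ∫ s in Ioo t T, (α * ‖w.1.fst s‖ ^ 2 - Real.exp (2 * κ * T) * α⁻¹ * ‖F s‖ ^ 2)
      ≤ ∫ s in Ioo t T, energyRate j κ w.1.fst w.1.snd s := by
    refine integral_mono_ae ((hi1.const_mul _).sub (hi2.const_mul _))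
      ((integrableOn_energyRate j _ hf hσ).mono_set hsub) ?_
    refine ae_restrict_of_ae_restrict_of_subset hsub ?_
    filter_upwards [heq, ha, ae_restrict_mem measurableSet_Ioo] with s h1 h2 h3
    have h4 := h2 (w.1.fst s)
    have h5 : w.1.snd s = a s (w.1.fst s) - F s := by rw [← h1]; abel
    have h6 : F s (w.1.fst s) ≤ ‖F s‖ * ‖w.1.fst s‖ :=
      (le_abs_self _).trans ((F s).le_opNorm _)
    set p := ‖w.1.fst s‖
    set r := ‖F s‖
    have hE1 : 1 ≤ Real.exp (2 * κ * s) := Real.one_le_exp (by have := h3.1.le; positivity)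
    have hE2 : Real.exp (2 * κ * s) ≤ Real.exp (2 * κ * T) :=
      Real.exp_le_exp.2 (by nlinarith [h3.2])
    -- Young's inequality splits the source term
    have h7 : 2 * (r * p) ≤ α * p ^ 2 + α⁻¹ * r ^ 2 := by
      have : α * p ^ 2 + α⁻¹ * r ^ 2 - 2 * (r * p) = α⁻¹ * (α * p - r) ^ 2 := by
        field_simp
        ring
      nlinarith [mul_nonneg (inv_pos.2 hα).le (sq_nonneg (α * p - r))]
    have h8 : α * p ^ 2 - α⁻¹ * r ^ 2
        ≤ 2 * w.1.snd s (w.1.fst s) + 2 * κ * ‖j (w.1.fst s)‖ ^ 2 := by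
      rw [h5, sub_apply]
      linarith
    have h9 := mul_le_mul_of_nonneg_left h8 (Real.exp_pos (2 * κ * s)).le
    have h10 : 0 ≤ α * p ^ 2 := by positivity
    have h11 : 0 ≤ α⁻¹ * r ^ 2 := by positivity
    simp only [energyRate]
    nlinarith
  rw [integral_sub (hi1.const_mul _) (hi2.const_mul _), integral_const_mul, integral_const_mul,
    ← hid] at hle
  have hFle : ∫ s in Ioo t T, ‖F s‖ ^ 2 ≤ ‖F‖ ^ 2 := by
    rw [norm_Lp_sq]
    exact setIntegral_mono_set (integrable_norm_sq hF) (Eventually.of_forall fun s => by positivity)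
      (LE.le.eventuallyLE hsub)
  have hE : 1 ≤ Real.exp (2 * κ * t) := Real.one_le_exp (by have := ht.1; positivity)
  have h1 : ‖Q t‖ ^ 2 ≤ Real.exp (2 * κ * t) * ‖Q t‖ ^ 2 :=
    le_mul_of_one_le_left (by positivity) hE
  have h2 := mul_le_mul_of_nonneg_left hFle
    (mul_pos (Real.exp_pos (2 * κ * T)) (inv_pos.2 hα)).le
  linarith

end Estimates

/-! ### Closedness of the set of solvable data -/

section Existence

variable {E H : Type*} [NormedAddCommGroup E] [InnerProductSpace ℝ E]
  [NormedAddCommGroup H] [InnerProductSpace ℝ H]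

theorem continuous_integral_mul {X : Type*} [NormedAddCommGroup X] [NormedSpace ℝ X] {T : ℝ}
    (ℓ : StrongDual ℝ X) {b : ℝ → ℝ} (hb : Continuous b) :
    Continuous fun f : Lp X 2 (intervalMeasure T) => ∫ t, ℓ (f t) * b t ∂intervalMeasure T := by
  obtain ⟨C, hC⟩ := isCompact_Icc.exists_bound_of_continuousOn (hb.continuousOn (s := Icc 0 T))
  have hbL : MemLp b 2 (intervalMeasure T) := by
    refine MemLp.of_bound hb.aestronglyMeasurable C ?_
    filter_upwards [ae_restrict_mem measurableSet_Ioo] with t ht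
    exact hC t (Ioo_subset_Icc_self ht)
  have hG : Continuous fun f : Lp X 2 (intervalMeasure T) =>
      (ContinuousLinearMap.mul ℝ ℝ).lpPairing (intervalMeasure T) 2 2
        (ContinuousLinearMap.compLpL 2 (intervalMeasure T) ℓ f) hbL.toLp :=
    ((ContinuousLinearMap.continuous _).comp (ContinuousLinearMap.continuous _)).clm_apply
      continuous_const
  refine hG.congr fun f => ?_
  rw [ContinuousLinearMap.lpPairing_eq_integral]
  refine integral_congr_ae ?_
  filter_upwards [ContinuousLinearMap.coeFn_compLpL (p := 2) ℓ f, hbL.coeFn_toLp] with t h1 h2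
  rw [h1, h2]; rfl

theorem isClosed_evolutionSpace (j : E →L[ℝ] H) (T : ℝ) :
    IsClosed (EvolutionSpace j T : Set (WithLp 2 (Lp E 2 (intervalMeasure T)
      × Lp (StrongDual ℝ E) 2 (intervalMeasure T)))) := by
  have e : (EvolutionSpace j T : Set (WithLp 2 (Lp E 2 (intervalMeasure T)
      × Lp (StrongDual ℝ E) 2 (intervalMeasure T)))) = ⋂ (φ : E) (ψ : ℝ → ℝ) (_ : IsTestFun T ψ),
      {w | ∫ t, inner ℝ (j (w.fst t)) (j φ) * deriv ψ t ∂intervalMeasure T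
        = -∫ t, w.snd t φ * ψ t ∂intervalMeasure T} := by
    ext w
    simp only [mem_iInter]
    rfl
  rw [e]
  refine isClosed_iInter fun φ => isClosed_iInter fun ψ => isClosed_iInter fun hψ => ?_
  have h1 := (continuous_integral_mul (T := T) ((innerSL ℝ (j φ)).comp j) hψ.continuous_deriv).comp
    (WithLp.fstL 2 ℝ (Lp E 2 (intervalMeasure T))
      (Lp (StrongDual ℝ E) 2 (intervalMeasure T))).continuous
  have h2 := (continuous_integral_mul (T := T) (ContinuousLinearMap.apply ℝ ℝ φ)
    hψ.smooth.continuous).comp (WithLp.sndL 2 ℝ (Lp E 2 (intervalMeasure T))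
      (Lp (StrongDual ℝ E) 2 (intervalMeasure T))).continuous
  refine isClosed_eq (h1.congr fun w => ?_) (h2.neg.congr fun w => ?_)
  · simp only [Function.comp_apply, ContinuousLinearMap.comp_apply, innerSL_apply_apply,
      WithLp.fstL_apply, real_inner_comm]
  · rfl

theorem cauchySeq_of_dist_le {X Y : Type*} [PseudoMetricSpace X] [PseudoMetricSpace Y] {x : ℕ → X}
    {y : ℕ → Y} (hy : CauchySeq y) {C : ℝ} (h : ∀ n m, dist (x n) (x m) ≤ C * dist (y n) (y m)) :
    CauchySeq x := by
  have h' : ∀ n m, dist (x n) (x m) ≤ (|C| + 1) * dist (y n) (y m) := fun n m =>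
    (h n m).trans (mul_le_mul_of_nonneg_right (by linarith [le_abs_self C]) dist_nonneg)
  rw [Metric.cauchySeq_iff] at hy ⊢
  intro ε hε
  have hC : 0 < |C| + 1 := by positivity
  obtain ⟨N, hN⟩ := hy (ε / (|C| + 1)) (by positivity)
  refine ⟨N, fun m hm n hn => (h' m n).trans_lt ?_⟩
  rw [mul_comm, ← lt_div_iff₀ hC]
  exact hN m hm n hn

/-- `w`, with continuous representative `Q`, solves `-∂ₜw + A w = F`, `w(T) = g`. -/
structure IsBackwardSolution (j : E →L[ℝ] H) {T : ℝ}
    (A : Lp E 2 (intervalMeasure T) →L[ℝ] Lp (StrongDual ℝ E) 2 (intervalMeasure T))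
    (F : Lp (StrongDual ℝ E) 2 (intervalMeasure T)) (g : H) (w : EvolutionSpace j T)
    (Q : ℝ → H) : Prop where
  continuousOn : ContinuousOn Q (Icc 0 T)
  ae_eq : ∀ᵐ t ∂intervalMeasure T, Q t = j (w.1.fst t)
  equation : -w.1.snd + A w.1.fst = F
  terminal : Q T = g

variable {j : E →L[ℝ] H} {T : ℝ}
  {A A' : Lp E 2 (intervalMeasure T) →L[ℝ] Lp (StrongDual ℝ E) 2 (intervalMeasure T)}
  {a : ℝ → E →L[ℝ] StrongDual ℝ E} {α κ : ℝ}

theorem IsBackwardSolution.add {F F' : Lp (StrongDual ℝ E) 2 (intervalMeasure T)} {g g' : H}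
    {w w' : EvolutionSpace j T} {Q Q' : ℝ → H} (h : IsBackwardSolution j A F g w Q)
    (h' : IsBackwardSolution j A F' g' w' Q') :
    IsBackwardSolution j A (F + F') (g + g') (w + w') (fun t => Q t + Q' t) where
  continuousOn := h.continuousOn.add h'.continuousOn
  ae_eq := by
    filter_upwards [h.ae_eq, h'.ae_eq, Lp.coeFn_add w.1.fst w'.1.fst] with t h1 h2 h3
    have : (w + w').1.fst = w.1.fst + w'.1.fst := rfl
    rw [h1, h2, this, h3, Pi.add_apply, map_add]
  equation := by
    have e1 : (w + w').1.fst = w.1.fst + w'.1.fst := rfl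
    have e2 : (w + w').1.snd = w.1.snd + w'.1.snd := rfl
    rw [e1, e2, map_add, ← h.equation, ← h'.equation]
    abel
  terminal := by rw [h.terminal, h'.terminal]

theorem IsBackwardSolution.smul {F : Lp (StrongDual ℝ E) 2 (intervalMeasure T)} {g : H}
    {w : EvolutionSpace j T} {Q : ℝ → H} (c : ℝ) (h : IsBackwardSolution j A F g w Q) :
    IsBackwardSolution j A (c • F) (c • g) (c • w) (fun t => c • Q t) where
  continuousOn := h.continuousOn.const_smul c
  ae_eq := by
    filter_upwards [h.ae_eq, Lp.coeFn_smul c w.1.fst] with t h1 h3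
    have : (c • w).1.fst = c • w.1.fst := rfl
    rw [h1, this, h3, Pi.smul_apply, map_smul]
  equation := by
    have e1 : (c • w).1.fst = c • w.1.fst := rfl
    have e2 : (c • w).1.snd = c • w.1.snd := rfl
    rw [e1, e2, map_smul, ← h.equation, smul_add, smul_neg]
  terminal := by rw [h.terminal]

theorem IsBackwardSolution.sub {F F' : Lp (StrongDual ℝ E) 2 (intervalMeasure T)} {g g' : H}
    {w w' : EvolutionSpace j T} {Q Q' : ℝ → H} (h : IsBackwardSolution j A F g w Q)
    (h' : IsBackwardSolution j A F' g' w' Q') :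
    IsBackwardSolution j A (F - F') (g - g') (w - w') (fun t => Q t - Q' t) := by
  have := h.add (h'.smul (-1))
  simpa only [neg_smul, one_smul, ← sub_eq_add_neg] using this

theorem IsBackwardSolution.ae_equation {F : Lp (StrongDual ℝ E) 2 (intervalMeasure T)} {g : H}
    {w : EvolutionSpace j T} {Q : ℝ → H} (hA : ∀ f, ∀ᵐ t ∂intervalMeasure T, A f t = a t (f t))
    (h : IsBackwardSolution j A F g w Q) :
    ∀ᵐ t ∂intervalMeasure T, -w.1.snd t + a t (w.1.fst t) = F t := by
  filter_upwards [hA w.1.fst, Lp.coeFn_add (-w.1.snd) (A w.1.fst), Lp.coeFn_neg w.1.snd]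
    with t h1 h2 h3
  rw [← h.equation, h2, Pi.add_apply, h3, h1, Pi.neg_apply]

theorem IsBackwardSolution.norm_rep_sq_le (hT : 0 < T) (hκ : 0 ≤ κ) (hα : 0 < α)
    (ha : IsGarding j T α κ a) (hA : ∀ f, ∀ᵐ t ∂intervalMeasure T, A f t = a t (f t))
    {F : Lp (StrongDual ℝ E) 2 (intervalMeasure T)} {g : H}
    {w : EvolutionSpace j T} {Q : ℝ → H} (h : IsBackwardSolution j A F g w Q) {t : ℝ}
    (ht : t ∈ Icc 0 T) :
    ‖Q t‖ ^ 2 ≤ Real.exp (2 * κ * T) * (‖g‖ ^ 2 + α⁻¹ * ‖F‖ ^ 2) := by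
  have h1 := backward_estimate hT hκ hα ha w F (h.ae_equation hA) h.continuousOn h.ae_eq ht
  rw [h.terminal] at h1
  have : 0 ≤ ∫ s in t..T, ‖w.1.fst s‖ ^ 2 :=
    intervalIntegral.integral_nonneg ht.2 fun s _ => by positivity
  nlinarith

theorem IsBackwardSolution.norm_fst_sq_le (hT : 0 < T) (hκ : 0 ≤ κ) (hα : 0 < α)
    (ha : IsGarding j T α κ a) (hA : ∀ f, ∀ᵐ t ∂intervalMeasure T, A f t = a t (f t))
    {F : Lp (StrongDual ℝ E) 2 (intervalMeasure T)} {g : H}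
    {w : EvolutionSpace j T} {Q : ℝ → H} (h : IsBackwardSolution j A F g w Q) :
    α * ‖w.1.fst‖ ^ 2 ≤ Real.exp (2 * κ * T) * (‖g‖ ^ 2 + α⁻¹ * ‖F‖ ^ 2) := by
  have h1 := backward_estimate hT hκ hα ha w F (h.ae_equation hA) h.continuousOn h.ae_eq
    (left_mem_Icc.2 hT.le)
  rw [h.terminal, intervalIntegral.integral_of_le hT.le, integral_Ioc_eq_integral_Ioo,
    ← norm_Lp_sq] at h1
  nlinarith [sq_nonneg ‖Q 0‖]

/-- The data for which the backward problem is solvable form a closed set: by the energy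
estimates, the solutions of a convergent sequence of problems converge in `W(0,T)` and uniformly
in `H`. -/
theorem exists_isBackwardSolution_of_tendsto [CompleteSpace E] [CompleteSpace H] (hT : 0 < T)
    (hκ : 0 ≤ κ) (hα : 0 < α) (ha : IsGarding j T α κ a)
    (hA : ∀ f, ∀ᵐ t ∂intervalMeasure T, A f t = a t (f t))
    {F : ℕ → Lp (StrongDual ℝ E) 2 (intervalMeasure T)} {g : ℕ → H} {w : ℕ → EvolutionSpace j T}
    {Q : ℕ → ℝ → H} (h : ∀ n, IsBackwardSolution j A (F n) (g n) (w n) (Q n))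
    {F₀ : Lp (StrongDual ℝ E) 2 (intervalMeasure T)} {g₀ : H} (hF : Tendsto F atTop (𝓝 F₀))
    (hg : Tendsto g atTop (𝓝 g₀)) :
    ∃ w Q, IsBackwardSolution j A F₀ g₀ w Q := by
  let y : ℕ → H × Lp (StrongDual ℝ E) 2 (intervalMeasure T) := fun n => (g n, F n)
  have hy : CauchySeq y := (hg.prodMk_nhds hF).cauchySeq
  have hbd : ∀ n m, ‖g n - g m‖ ^ 2 + α⁻¹ * ‖F n - F m‖ ^ 2
      ≤ (1 + α⁻¹) * dist (y n) (y m) ^ 2 := fun n m => by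
    have h1 : ‖g n - g m‖ ≤ dist (y n) (y m) := by
      rw [← dist_eq_norm]; exact le_max_left _ _
    have h2 : ‖F n - F m‖ ≤ dist (y n) (y m) := by
      rw [← dist_eq_norm]; exact le_max_right _ _
    have h3 : ‖g n - g m‖ ^ 2 ≤ dist (y n) (y m) ^ 2 := by gcongr
    have h4 : ‖F n - F m‖ ^ 2 ≤ dist (y n) (y m) ^ 2 := by gcongr
    have := mul_le_mul_of_nonneg_left h4 (inv_pos.2 hα).le
    linarith
  -- a common Lipschitz constant for the solution maps
  obtain ⟨C, hC, hC1, hC2⟩ : ∃ C : ℝ, 0 ≤ C ∧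
      (∀ n m, dist (w n).1.fst (w m).1.fst ≤ C * dist (y n) (y m)) ∧
      ∀ n m, ∀ t ∈ Icc 0 T, dist (Q n t) (Q m t) ≤ C * dist (y n) (y m) := by
    have hK : 0 ≤ Real.exp (2 * κ * T) * (1 + α⁻¹) := by positivity
    refine ⟨√(Real.exp (2 * κ * T) * (1 + α⁻¹)) * (1 + √(α⁻¹)), by positivity,
      fun n m => ?_, fun n m t ht => ?_⟩
    · have h1 := ((h n).sub (h m)).norm_fst_sq_le hT hκ hα ha hA
      rw [dist_eq_norm]
      refine abs_le_of_sq_le_sq' ?_ (by positivity) |>.2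
      have h2 : ‖(w n).1.fst - (w m).1.fst‖ ^ 2
          ≤ α⁻¹ * (Real.exp (2 * κ * T) * ((1 + α⁻¹) * dist (y n) (y m) ^ 2)) := by
        rw [← div_eq_inv_mul, le_div_iff₀ hα, mul_comm]
        exact h1.trans (mul_le_mul_of_nonneg_left (hbd n m) (Real.exp_pos _).le)
      rw [mul_pow, mul_pow, Real.sq_sqrt hK]
      refine h2.trans ?_
      have h3 : α⁻¹ ≤ (1 + √(α⁻¹)) ^ 2 := by
        nlinarith [Real.sq_sqrt (inv_pos.2 hα).le, Real.sqrt_nonneg α⁻¹]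
      have h4 : 0 ≤ Real.exp (2 * κ * T) * (1 + α⁻¹) * dist (y n) (y m) ^ 2 := by positivity
      nlinarith [mul_le_mul_of_nonneg_right h3 h4]
    · have h1 := ((h n).sub (h m)).norm_rep_sq_le hT hκ hα ha hA ht
      rw [dist_eq_norm]
      refine abs_le_of_sq_le_sq' ?_ (by positivity) |>.2
      have h2 : ‖Q n t - Q m t‖ ^ 2
          ≤ Real.exp (2 * κ * T) * ((1 + α⁻¹) * dist (y n) (y m) ^ 2) :=
        h1.trans (mul_le_mul_of_nonneg_left (hbd n m) (Real.exp_pos _).le)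
      rw [mul_pow, mul_pow, Real.sq_sqrt hK]
      refine h2.trans ?_
      have h3 : 1 ≤ (1 + √(α⁻¹)) ^ 2 := by nlinarith [Real.sqrt_nonneg α⁻¹]
      have h4 : 0 ≤ Real.exp (2 * κ * T) * (1 + α⁻¹) * dist (y n) (y m) ^ 2 := by positivity
      nlinarith [mul_le_mul_of_nonneg_right h3 h4]
  obtain ⟨f, hf⟩ := cauchySeq_tendsto_of_complete (cauchySeq_of_dist_le hy hC1)
  have hsnd : ∀ n, (w n).1.snd = A (w n).1.fst - F n := fun n => by
    rw [← (h n).equation]; abel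
  have hs : Tendsto (fun n => (w n).1.snd) atTop (𝓝 (A f - F₀)) := by
    simp only [hsnd]
    exact ((A.continuous.tendsto f).comp hf).sub hF
  -- the limit lies in `W(0,T)`
  have hmem : (WithLp.toLp 2 (f, A f - F₀) : WithLp 2 (Lp E 2 (intervalMeasure T)
      × Lp (StrongDual ℝ E) 2 (intervalMeasure T))) ∈ EvolutionSpace j T := by
    refine (isClosed_evolutionSpace j T).mem_of_tendsto (b := atTop)
      (((WithLp.prod_continuous_toLp 2 _ _).tendsto _).comp (hf.prodMk_nhds hs))
      (Eventually.of_forall fun n => (w n).2)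
  -- the representatives converge uniformly
  have hQex : ∀ t, ∃ q, t ∈ Icc 0 T → Tendsto (fun n => Q n t) atTop (𝓝 q) := fun t => by
    by_cases ht : t ∈ Icc 0 T
    · obtain ⟨q, hq⟩ := cauchySeq_tendsto_of_complete
        (cauchySeq_of_dist_le hy fun n m => hC2 n m t ht)
      exact ⟨q, fun _ => hq⟩
    · exact ⟨0, fun h => absurd h ht⟩
  choose Q₀ hQ₀ using hQex
  have hy0 : Tendsto y atTop (𝓝 (g₀, F₀)) := hg.prodMk_nhds hF
  have hunif : TendstoUniformlyOn Q Q₀ atTop (Icc 0 T) := by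
    rw [Metric.tendstoUniformlyOn_iff]
    intro ε hε
    have h0 : Tendsto (fun n => C * dist (y n) (g₀, F₀)) atTop (𝓝 0) := by
      have := (tendsto_iff_dist_tendsto_zero.1 hy0).const_mul C
      rwa [mul_zero] at this
    filter_upwards [h0.eventually (gt_mem_nhds hε)] with n hn t ht
    refine lt_of_le_of_lt ?_ hn
    rw [dist_comm]
    exact le_of_tendsto_of_tendsto (tendsto_const_nhds.dist (hQ₀ t ht))
      ((tendsto_const_nhds.dist hy0).const_mul C) (Eventually.of_forall fun m => hC2 n m t ht)
  refine ⟨⟨_, hmem⟩, Q₀,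
    hunif.continuousOn (Eventually.of_forall fun n => (h n).continuousOn).frequently,
    ?_, ?_, ?_⟩
  · obtain ⟨ns, hns, hae⟩ := (tendstoInMeasure_of_tendsto_Lp hf).exists_seq_tendsto_ae
    filter_upwards [hae, ae_all_iff.2 fun n => (h n).ae_eq, ae_restrict_mem measurableSet_Ioo]
      with t h1 h2 h3
    have h4 := (hQ₀ t (Ioo_subset_Icc_self h3)).comp hns.tendsto_atTop
    have h5 := (j.continuous.tendsto _).comp h1
    refine tendsto_nhds_unique h4 (h5.congr fun n => ?_)
    simp only [Function.comp_apply, h2]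
  · change -(A f - F₀) + A f = F₀
    abel
  · exact tendsto_nhds_unique (hQ₀ T (right_mem_Icc.2 hT.le))
      (hg.congr fun n => ((h n).terminal).symm)

end Existence

/-! ### Solvability of the backward problem -/

section Solvability

variable {E H : Type*} [NormedAddCommGroup E] [InnerProductSpace ℝ E]
  [NormedAddCommGroup H] [InnerProductSpace ℝ H]

theorem memLp_of_continuous {F : Type*} [NormedAddCommGroup F] {T : ℝ} {f : ℝ → F}
    (hf : Continuous f) : MemLp f 2 (intervalMeasure T) := by
  obtain ⟨C, hC⟩ := isCompact_Icc.exists_bound_of_continuousOn (hf.continuousOn (s := Icc 0 T))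
  refine MemLp.of_bound hf.aestronglyMeasurable C ?_
  filter_upwards [ae_restrict_mem measurableSet_Ioo] with t ht
  exact hC t (Ioo_subset_Icc_self ht)

/-- The functions `t ↦ ψ(t) e` with `ψ` smooth and `e ∈ V` belong to `W(0,T)`. -/
theorem exists_tensor (j : E →L[ℝ] H) {T : ℝ} (hT : 0 < T) {ψ : ℝ → ℝ} (hψ : ContDiff ℝ ∞ ψ)
    (e : E) : ∃ w : EvolutionSpace j T, (∀ᵐ t ∂intervalMeasure T, w.1.fst t = ψ t • e) ∧
      ∀ᵐ t ∂intervalMeasure T, w.1.snd t = deriv ψ t • gramDual j e := by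
  have hd : Continuous (deriv ψ) := hψ.continuous_deriv (by simp)
  have h1 : MemLp (fun t => ψ t • e) 2 (intervalMeasure T) :=
    memLp_of_continuous (hψ.continuous.smul continuous_const)
  have h2 : MemLp (fun t => deriv ψ t • gramDual j e) 2 (intervalMeasure T) :=
    memLp_of_continuous (hd.smul continuous_const)
  refine ⟨⟨WithLp.toLp 2 (h1.toLp, h2.toLp), ?_⟩, h1.coeFn_toLp, h2.coeFn_toLp⟩
  refine (hasWeakTimeDeriv_iff j _ _).2 ?_
  have hc : IsWeakDerivOn 0 T (fun _ => gramDual j e) 0 :=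
    isWeakDerivOn_of_primitive hT.le integrableOn_zero (gramDual j e) (by simp)
  have hcs := hc.smooth_smul (by simp [integrableOn_const_iff]) integrableOn_zero hψ
  intro χ hχ hχc hχs
  rw [integral_congr_ae (g := fun t => deriv χ t • ψ t • gramDual j e),
    integral_congr_ae (f := fun t => χ t • _) (g := fun t => χ t • (ψ t • (0 : ℝ → StrongDual ℝ E) t
      + deriv ψ t • gramDual j e))]
  · exact hcs χ hχ hχc hχs
  · filter_upwards [h2.coeFn_toLp] with t ht
    simp only [WithLp.toLp_snd, ht, Pi.zero_apply, smul_zero, zero_add]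
  · filter_upwards [h1.coeFn_toLp] with t ht
    simp only [WithLp.toLp_fst, ht, map_smul]

variable {j : E →L[ℝ] H} {T : ℝ}
  {A A' : Lp E 2 (intervalMeasure T) →L[ℝ] Lp (StrongDual ℝ E) 2 (intervalMeasure T)}
  {a : ℝ → E →L[ℝ] StrongDual ℝ E} {α κ : ℝ}

/-- A weak solution `v` of the forward problem `∂ₜv + a* v = 0` with zero initial value vanishes.
The initial value is encoded by testing with functions that need not vanish at `0`, so that the
extension of `v` by zero solves the equation on `(-1, T)`. -/
theorem eq_zero_of_forward (hT : 0 < T) (hκ : 0 ≤ κ) (hα : 0 < α) (ha : IsGarding j T α κ a)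
    (hA' : ∀ f, ∀ᵐ t ∂intervalMeasure T, A' f t = (a t).flip (f t))
    (v : Lp E 2 (intervalMeasure T))
    (hv : ∀ (ψ : ℝ → ℝ) (e : E), ContDiff ℝ ∞ ψ → ψ T = 0 →
      ∫ t, (ψ t * a t e (v t) - deriv ψ t * inner ℝ (j e) (j (v t))) ∂intervalMeasure T = 0) :
    v = 0 := by
  have hsub : Ioo 0 T ⊆ Ioo (-1) T := Ioo_subset_Ioo_left (by norm_num)
  have hrr : (volume.restrict (Ioo (-1) T)).restrict (Ioo 0 T) = intervalMeasure T := by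
    rw [Measure.restrict_restrict measurableSet_Ioo, inter_eq_self_of_subset_left hsub]
  set f : ℝ → E := (Ioo 0 T).indicator v with hf_def
  set σ : ℝ → StrongDual ℝ E := (Ioo 0 T).indicator (fun t => -A' v t) with hσ_def
  have hvL := Lp.memLp v
  have hAL : MemLp (fun t => -A' v t) 2 (intervalMeasure T) := (Lp.memLp (A' v)).neg
  have hf : MemLp f 2 (volume.restrict (Ioo (-1) T)) := by
    rw [hf_def, memLp_indicator_iff_restrict measurableSet_Ioo, hrr]; exact hvL
  have hσ : MemLp σ 2 (volume.restrict (Ioo (-1) T)) := by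
    exact (memLp_indicator_iff_restrict (p := 2) (μ := volume.restrict (Ioo (-1) T)) (s := Ioo 0 T)
      (f := fun t => -A' v t) measurableSet_Ioo).2 (by rw [hrr]; exact hAL)
  have hJf : IntegrableOn (fun t => gramDual j (f t)) (Ioo (-1) T) :=
    (gramDual j).integrable_comp (hf.integrable one_le_two)
  have hw : IsWeakDerivOn (-1) T (fun t => gramDual j (f t)) σ := by
    intro χ hχ hχc hχs
    have hd : Continuous (deriv χ) := hχ.continuous_deriv (by simp)
    ext e
    rw [neg_apply,
      ContinuousLinearMap.integral_apply (integrableOn_smul_of_continuous hd hJf),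
      ContinuousLinearMap.integral_apply
        (integrableOn_smul_of_continuous hχ.continuous (hσ.integrable one_le_two))]
    have e1 : ∫ t in Ioo (-1) T, (deriv χ t • gramDual j (f t)) e
        = ∫ t, deriv χ t * inner ℝ (j e) (j (v t)) ∂intervalMeasure T := by
      rw [setIntegral_eq_of_subset_of_forall_sdiff_eq_zero measurableSet_Ioo hsub]
      · refine setIntegral_congr_fun measurableSet_Ioo fun t ht => ?_
        simp only [hf_def, indicator_of_mem ht, smul_apply, gramDual_apply, smul_eq_mul,
          real_inner_comm]
      · intro t ht
        simp [hf_def, indicator_of_notMem ht.2]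
    have e2 : ∫ t in Ioo (-1) T, (χ t • σ t) e
        = ∫ t, -(χ t * a t e (v t)) ∂intervalMeasure T := by
      rw [setIntegral_eq_of_subset_of_forall_sdiff_eq_zero measurableSet_Ioo hsub]
      · refine integral_congr_ae ?_
        filter_upwards [hA' v, ae_restrict_mem measurableSet_Ioo] with t h1 ht
        simp only [hσ_def, indicator_of_mem ht, smul_apply, neg_apply, h1,
          ContinuousLinearMap.flip_apply, smul_eq_mul, mul_neg]
      · intro t ht
        simp [hσ_def, indicator_of_notMem ht.2]
    have hT0 : χ T = 0 := image_eq_zero_of_notMem_tsupport fun h => by simpa using hχs h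
    have key := hv χ e hχ hT0
    have i1 : Integrable (fun t => χ t * a t e (v t)) (intervalMeasure T) := by
      have : Integrable (fun t => A' v t e) (intervalMeasure T) :=
        (memLp_pairing (A' v) e).integrable one_le_two
      refine (integrableOn_smul_of_continuous hχ.continuous this).congr ?_
      filter_upwards [hA' v] with t h1
      rw [h1, smul_eq_mul, ContinuousLinearMap.flip_apply]
    have i2 : Integrable (fun t => deriv χ t * inner ℝ (j e) (j (v t))) (intervalMeasure T) := by
      have : Integrable (fun t => inner ℝ (j (v t)) (j e)) (intervalMeasure T) :=
        (memLp_inner j v e).integrable one_le_two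
      refine (integrableOn_smul_of_continuous hd this).congr (Eventually.of_forall fun t => ?_)
      simp only [smul_eq_mul, real_inner_comm]
    rw [integral_sub i1 i2] at key
    rw [e1, e2, integral_neg]
    linarith
  have hlt : (-1 : ℝ) < T := by linarith
  obtain ⟨c, hc⟩ := exists_energy_ae_eq j (-κ) hlt hf hσ hw
  have hri := integrableOn_energyRate j (-κ) hf hσ
  have hrate0 : ∀ t, t ∉ Ioo 0 T → energyRate j (-κ) f σ t = 0 := fun t ht => by
    simp [energyRate, hf_def, hσ_def, indicator_of_notMem ht]
  -- the constant vanishes, since `f` is zero on `(-1, 0)`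
  have hc0 : c = 0 := by
    have hs0 : Ioo (-1 : ℝ) 0 ⊆ Ioo (-1) T := Ioo_subset_Ioo_right hT.le
    have h1 := ae_restrict_of_ae_restrict_of_subset hs0 hc
    have hne : (ae (volume.restrict (Ioo (-1 : ℝ) 0))).NeBot := by
      rw [ae_neBot, Ne, Measure.restrict_eq_zero]
      simp
    obtain ⟨t, ht, ht0⟩ := (h1.and (ae_restrict_mem measurableSet_Ioo)).exists
    have hft : f t = 0 := by
      rw [hf_def, indicator_of_notMem]
      exact fun h => absurd h.1 (not_lt.2 ht0.2.le)
    rw [hft, intervalIntegral.integral_congr (g := fun _ => (0 : ℝ))] at ht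
    · simpa using ht.symm
    · intro s hs
      rw [uIcc_of_le ht0.1.le] at hs
      exact hrate0 s fun h => absurd h.1 (not_lt.2 (hs.2.trans ht0.2.le))
  set β := 2 * α * Real.exp (-(2 * κ * T)) with hβ
  have hβ0 : 0 < β := by positivity
  have hn := integrable_norm_sq hf
  have hrate : ∀ᵐ t ∂volume.restrict (Ioo (-1) T),
      energyRate j (-κ) f σ t ≤ -β * ‖f t‖ ^ 2 := by
    have hg := (ae_restrict_iff' measurableSet_Ioo).1 (ha.and (hA' v))
    refine ae_restrict_of_ae ?_
    filter_upwards [hg] with t h1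
    by_cases ht : t ∈ Ioo 0 T
    · obtain ⟨h2, h3⟩ := h1 ht
      have h4 := h2 (v t)
      have hexp : Real.exp (-(2 * κ * T)) ≤ Real.exp (2 * (-κ) * t) :=
        Real.exp_le_exp.2 (by nlinarith [ht.2])
      simp only [energyRate, hf_def, hσ_def, indicator_of_mem ht, h3, neg_apply,
        ContinuousLinearMap.flip_apply]
      have h5 : Real.exp (-(2 * κ * T)) * (α * ‖v t‖ ^ 2)
          ≤ Real.exp (2 * (-κ) * t) * (α * ‖v t‖ ^ 2) :=
        mul_le_mul_of_nonneg_right hexp (by positivity)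
      have h6 := mul_le_mul_of_nonneg_left h4 (Real.exp_pos (2 * (-κ) * t)).le
      rw [hβ]
      nlinarith
    · rw [hrate0 t ht]
      simp [hf_def, indicator_of_notMem ht]
  -- hence `∫ ‖f‖²` vanishes on `(-1, t)` for almost every `t`, and so up to `T`
  have hprim : EqOn (fun t => ∫ s in (-1 : ℝ)..t, ‖f s‖ ^ 2) (fun _ => 0) (Icc (-1) T) := by
    refine eqOn_Icc_of_ae hlt (continuousOn_primitive_Icc hlt.le hn) continuousOn_const ?_
    filter_upwards [hc, ae_restrict_mem measurableSet_Ioo] with t h1 ht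
    rw [hc0, zero_add] at h1
    have h2 : 0 ≤ ∫ s in (-1 : ℝ)..t, energyRate j (-κ) f σ s := by
      rw [← h1]; positivity
    have hst : Ioo (-1) t ⊆ Ioo (-1) T := Ioo_subset_Ioo_right ht.2.le
    rw [intervalIntegral.integral_of_le ht.1.le, integral_Ioc_eq_integral_Ioo] at h2 ⊢
    have h3 : ∫ s in Ioo (-1) t, energyRate j (-κ) f σ s
        ≤ ∫ s in Ioo (-1) t, -β * ‖f s‖ ^ 2 :=
      integral_mono_ae (hri.mono_set hst) ((IntegrableOn.mono_set hn hst).const_mul _)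
        (ae_restrict_of_ae_restrict_of_subset hst hrate)
    rw [integral_const_mul] at h3
    have h4 : 0 ≤ ∫ s in Ioo (-1) t, ‖f s‖ ^ 2 := integral_nonneg fun s => by positivity
    nlinarith
  have hfin := hprim (right_mem_Icc.2 hlt.le)
  simp only at hfin
  rw [intervalIntegral.integral_of_le hlt.le, integral_Ioc_eq_integral_Ioo,
    setIntegral_eq_of_subset_of_forall_sdiff_eq_zero measurableSet_Ioo hsub
      (fun t ht => by simp [hf_def, indicator_of_notMem ht.2]),
    setIntegral_congr_fun (g := fun t => ‖v t‖ ^ 2) measurableSet_Ioo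
      (fun t ht => by simp only [hf_def, indicator_of_mem ht])] at hfin
  rw [← norm_eq_zero, ← sq_eq_zero_iff, norm_Lp_sq]
  exact hfin

/-- Solvability of the backward problem. The set of data for which a solution exists is a closed
subspace, and an element `(v, h)` of its orthogonal complement is a weak solution of the forward
problem with zero initial value, hence is zero. -/
theorem exists_isBackwardSolution [CompleteSpace E] [CompleteSpace H] (hT : 0 < T) (hκ : 0 ≤ κ)
    (hα : 0 < α) (ha : IsGarding j T α κ a) (hj : DenseRange j)
    (hA : ∀ f, ∀ᵐ t ∂intervalMeasure T, A f t = a t (f t))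
    (hA' : ∀ f, ∀ᵐ t ∂intervalMeasure T, A' f t = (a t).flip (f t))
    (F : Lp (StrongDual ℝ E) 2 (intervalMeasure T)) (g : H) :
    ∃ w Q, IsBackwardSolution j A F g w Q := by
  let riesz : E →L[ℝ] StrongDual ℝ E := innerSL ℝ
  let rieszInv : StrongDual ℝ E →L[ℝ] E :=
    { toFun := (InnerProductSpace.toDual ℝ E).symm
      map_add' := map_add _
      map_smul' := fun c x => by simp
      cont := (InnerProductSpace.toDual ℝ E).symm.continuous }
  have hinv : ∀ x, riesz (rieszInv x) = x := fun x =>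
    (InnerProductSpace.toDual ℝ E).apply_symm_apply x
  let Φ := riesz.compLpL 2 (intervalMeasure T)
  let Ψ := rieszInv.compLpL 2 (intervalMeasure T)
  have hΦΨ : ∀ F, Φ (Ψ F) = F := fun F => by
    refine Lp.ext ?_
    filter_upwards [riesz.coeFn_compLpL (Ψ F), rieszInv.coeFn_compLpL F] with t h1 h2
    rw [h1, h2, hinv]
  let K : Submodule ℝ (WithLp 2 (Lp E 2 (intervalMeasure T) × H)) :=
    { carrier := {y | ∃ w Q, IsBackwardSolution j A (Φ y.fst) y.snd w Q}
      add_mem' := by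
        rintro y y' ⟨w, Q, h⟩ ⟨w', Q', h'⟩
        refine ⟨w + w', fun t => Q t + Q' t, ?_⟩
        rw [WithLp.add_fst, WithLp.add_snd, map_add]
        exact h.add h'
      zero_mem' := by
        refine ⟨0, 0, ⟨continuousOn_const, ?_, ?_, rfl⟩⟩
        · filter_upwards [Lp.coeFn_zero E 2 (intervalMeasure T)] with t ht
          have : (0 : EvolutionSpace j T).1.fst = 0 := rfl
          rw [this, ht, Pi.zero_apply, Pi.zero_apply, map_zero]
        · have e1 : (0 : EvolutionSpace j T).1.fst = 0 := rfl
          have e2 : (0 : EvolutionSpace j T).1.snd = 0 := rfl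
          rw [e1, e2, WithLp.zero_fst, map_zero, map_zero, neg_zero, zero_add]
      smul_mem' := by
        rintro c y ⟨w, Q, h⟩
        refine ⟨c • w, fun t => c • Q t, ?_⟩
        rw [WithLp.smul_fst, WithLp.smul_snd, map_smul]
        exact h.smul c }
  have hK : IsClosed (K : Set (WithLp 2 (Lp E 2 (intervalMeasure T) × H))) := by
    refine IsSeqClosed.isClosed fun y y₀ hy hy₀ => ?_
    choose w Q h using hy
    exact exists_isBackwardSolution_of_tendsto hT hκ hα ha hA h
      ((Φ.continuous.tendsto _).comp (((WithLp.fstL 2 ℝ _ _).continuous.tendsto y₀).comp hy₀))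
      (((WithLp.sndL 2 ℝ _ _).continuous.tendsto y₀).comp hy₀)
  have hbot : Kᗮ = ⊥ := by
    rw [Submodule.eq_bot_iff]
    intro z hz
    rw [Submodule.mem_orthogonal] at hz
    -- orthogonality to the data produced by `t ↦ ψ(t) e`
    have htest : ∀ (ψ : ℝ → ℝ) (e : E), ContDiff ℝ ∞ ψ →
        (∫ t, (ψ t * a t e (z.fst t) - deriv ψ t * inner ℝ (j e) (j (z.fst t))) ∂intervalMeasure T)
          + ψ T * inner ℝ (j e) z.snd = 0 := by
      intro ψ e hψ
      obtain ⟨w, h1, h2⟩ := exists_tensor j hT hψ e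
      have hs : IsBackwardSolution j A (-w.1.snd + A w.1.fst) (ψ T • j e) w (fun t => ψ t • j e) :=
        ⟨(hψ.continuous.smul continuous_const).continuousOn, by
          filter_upwards [h1] with t ht
          rw [ht, map_smul], rfl, rfl⟩
      have := hz (WithLp.toLp 2 (Ψ (-w.1.snd + A w.1.fst), ψ T • j e)) ⟨w, _, by
        simpa only [WithLp.toLp_fst, WithLp.toLp_snd, hΦΨ] using hs⟩
      rw [WithLp.prod_inner_apply, L2.inner_def] at this
      rw [← this]
      congr 1
      · refine integral_congr_ae ?_
        filter_upwards [rieszInv.coeFn_compLpL (-w.1.snd + A w.1.fst),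
          Lp.coeFn_add (-w.1.snd) (A w.1.fst), Lp.coeFn_neg w.1.snd, hA w.1.fst, h1, h2]
          with t t1 t2 t3 t4 t5 t6
        change _ = inner ℝ (Ψ (-w.1.snd + A w.1.fst) t) (z.fst t)
        rw [t1, t2, Pi.add_apply, t3, t4, Pi.neg_apply, t5, t6]
        have hr : ∀ x, inner ℝ (rieszInv x) (z.fst t) = x (z.fst t) := fun x =>
          InnerProductSpace.toDual_symm_apply (𝕜 := ℝ) (E := E)
        rw [hr]
        simp only [map_smul, add_apply, neg_apply, smul_apply, gramDual_apply, smul_eq_mul]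
        ring
      · exact (real_inner_smul_left _ _ _).symm
    have hv : z.fst = 0 := eq_zero_of_forward hT hκ hα ha hA' z.fst fun ψ e hψ hψT => by
      have := htest ψ e hψ
      rwa [hψT, zero_mul, add_zero] at this
    have hh : z.snd = 0 := by
      refine Dense.eq_zero_of_inner_right ℝ hj ?_
      rintro _ ⟨e, rfl⟩
      have h1 := htest (fun _ => 1) e contDiff_const
      have h2 : ∫ t, ((1 : ℝ) * a t e (z.fst t)
          - deriv (fun _ : ℝ => (1 : ℝ)) t * inner ℝ (j e) (j (z.fst t)))
            ∂intervalMeasure T = 0 := by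
        refine integral_eq_zero_of_ae ?_
        rw [hv]
        filter_upwards [Lp.coeFn_zero E 2 (intervalMeasure T)] with t ht
        simp only [ht, Pi.zero_apply, map_zero, inner_zero_right, mul_zero, sub_zero]
      rw [h2, zero_add, one_mul] at h1
      exact h1
    refine WithLp.ofLp_injective 2 (Prod.ext hv hh)
  have htop : K = ⊤ := by
    have := Submodule.topologicalClosure_eq_top_iff.2 hbot
    rwa [hK.submodule_topologicalClosure_eq] at this
  have hmem : (WithLp.toLp 2 (Ψ F, g) : WithLp 2 (Lp E 2 (intervalMeasure T) × H)) ∈ K :=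
    htop ▸ Submodule.mem_top
  obtain ⟨w, Q, h⟩ := hmem
  refine ⟨w, Q, ?_⟩
  simpa only [WithLp.toLp_fst, WithLp.toLp_snd, hΦΨ] using h

end Solvability

/-! ### Measurable families of operators -/

section Operators

variable {E : Type*} [NormedAddCommGroup E] [InnerProductSpace ℝ E]

theorem countable_of_orthonormal [TopologicalSpace.SeparableSpace E] {w : Set E}
    (hw : Orthonormal ℝ ((↑) : w → E)) : w.Countable := by
  have hd : w.PairwiseDisjoint fun x => Metric.ball x (1 / 2) := by
    intro x hx y hy hxy
    refine Metric.ball_disjoint_ball ?_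
    have h1 : ‖x‖ = 1 := hw.1 ⟨x, hx⟩
    have h2 : ‖y‖ = 1 := hw.1 ⟨y, hy⟩
    have h3 : inner ℝ x y = 0 := hw.2 (i := ⟨x, hx⟩) (j := ⟨y, hy⟩) (by simpa using hxy)
    have h4 : ‖x - y‖ ^ 2 = 2 := by
      rw [norm_sub_sq_real, h1, h2, h3]; norm_num
    rw [dist_eq_norm]
    nlinarith [norm_nonneg (x - y)]
  exact hd.countable_of_isOpen (fun _ _ => Metric.isOpen_ball)
    fun x _ => ⟨x, Metric.mem_ball_self (by norm_num)⟩

/-- Pettis' measurability theorem in a separable Hilbert space. -/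
theorem aestronglyMeasurable_of_inner [CompleteSpace E] [TopologicalSpace.SeparableSpace E]
    {μ : Measure ℝ} {f : ℝ → E}
    (h : ∀ e, AEStronglyMeasurable (fun t => inner ℝ e (f t)) μ) : AEStronglyMeasurable f μ := by
  obtain ⟨w, b, hb⟩ := exists_hilbertBasis ℝ E
  have hwc : Countable w := (countable_of_orthonormal (hb ▸ b.orthonormal)).to_subtype
  refine aestronglyMeasurable_of_tendsto_ae atTop
    (f := fun (s : Finset w) t => ∑ i ∈ s, inner ℝ (b i) (f t) • b i) (fun s => ?_)
    (Eventually.of_forall fun t => ?_)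
  · exact Finset.aestronglyMeasurable_fun_sum s fun i _ => (h (b i)).smul_const (b i)
  · have := b.hasSum_repr (f t)
    simp only [b.repr_apply_apply] at this
    exact this

theorem aestronglyMeasurable_dual_of_apply [CompleteSpace E] [TopologicalSpace.SeparableSpace E]
    {μ : Measure ℝ} {f : ℝ → StrongDual ℝ E}
    (h : ∀ e, AEStronglyMeasurable (fun t => f t e) μ) : AEStronglyMeasurable f μ := by
  have h1 : AEStronglyMeasurable (fun t => (InnerProductSpace.toDual ℝ E).symm (f t)) μ :=
    aestronglyMeasurable_of_inner fun e => (h e).congr (Eventually.of_forall fun t => by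
      simp only
      rw [real_inner_comm]
      exact (InnerProductSpace.toDual_symm_apply (𝕜 := ℝ) (E := E)).symm)
  have h2 := (InnerProductSpace.toDual ℝ E).continuous.comp_aestronglyMeasurable h1
  simpa only [LinearIsometryEquiv.apply_symm_apply] using h2

/-- A bounded weakly measurable family of operators `a t : V → V*` acts on `L²(0,T;V)`. -/
theorem exists_lpOperator [CompleteSpace E] [TopologicalSpace.SeparableSpace E] {μ : Measure ℝ}
    {a : ℝ → E →L[ℝ] StrongDual ℝ E} {B : ℝ} (ha : ∀ t e, ‖a t e‖ ≤ B * ‖e‖)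
    (hm : ∀ e e', AEStronglyMeasurable (fun t => a t e e') μ) :
    ∃ A : Lp E 2 μ →L[ℝ] Lp (StrongDual ℝ E) 2 μ, (∀ f, ∀ᵐ t ∂μ, A f t = a t (f t)) ∧
      ∀ f, ‖A f‖ ≤ B * ‖f‖ := by
  have hflip : ∀ e, AEStronglyMeasurable (fun t => (a t).flip e) μ := fun e =>
    aestronglyMeasurable_dual_of_apply fun e' => hm e' e
  have hmeas : ∀ f : Lp E 2 μ, AEStronglyMeasurable (fun t => a t (f t)) μ := fun f =>
    aestronglyMeasurable_dual_of_apply fun e =>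
      ((ContinuousLinearMap.id ℝ (StrongDual ℝ E)).aestronglyMeasurable_comp₂ (hflip e)
        (Lp.aestronglyMeasurable f) :)
  have hL : ∀ f : Lp E 2 μ, MemLp (fun t => a t (f t)) 2 μ := fun f =>
    (Lp.memLp f).of_le_mul (hmeas f) (Eventually.of_forall fun t => ha t (f t))
  have hn : ∀ f : Lp E 2 μ, ‖(hL f).toLp‖ ≤ B * ‖f‖ := fun f => by
    refine Lp.norm_le_mul_norm_of_ae_le_mul ?_
    filter_upwards [(hL f).coeFn_toLp] with t ht
    rw [ht]
    exact ha t (f t)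
  let A₀ : Lp E 2 μ →ₗ[ℝ] Lp (StrongDual ℝ E) 2 μ :=
    { toFun := fun f => (hL f).toLp
      map_add' := fun f g => by
        refine Lp.ext ?_
        filter_upwards [(hL (f + g)).coeFn_toLp, Lp.coeFn_add (hL f).toLp (hL g).toLp,
          (hL f).coeFn_toLp, (hL g).coeFn_toLp, Lp.coeFn_add f g] with t h1 h2 h3 h4 h5
        rw [h1, h2, Pi.add_apply, h3, h4, h5, Pi.add_apply, map_add]
      map_smul' := fun c f => by
        refine Lp.ext ?_
        filter_upwards [(hL (c • f)).coeFn_toLp, Lp.coeFn_smul c (hL f).toLp,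
          (hL f).coeFn_toLp, Lp.coeFn_smul c f] with t h1 h2 h3 h5
        rw [h1, RingHom.id_apply, h2, Pi.smul_apply, h3, h5, Pi.smul_apply, map_smul] }
  exact ⟨A₀.mkContinuous B hn, fun f => (hL f).coeFn_toLp, hn⟩

end Operators

/-! ### The energy space of the star graph -/

section EnergySpace

variable {N : ℕ} {l : Fin N → ℝ}

theorem hasWeakDeriv_iff {a : ℝ} {f g : ℝ → ℝ} : HasWeakDeriv a f g ↔ IsWeakDerivOn 0 a f g := by
  constructor
  · intro h ψ h1 h2 h3
    simpa only [smul_eq_mul, mul_comm] using h ψ ⟨h1, h2, h3⟩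
  · intro h ψ hψ
    simpa only [smul_eq_mul, mul_comm] using h ψ hψ.smooth hψ.compact hψ.supp

theorem isClosed_H1 (l : Fin N → ℝ) : IsClosed (H1 l : Set (WithLp 2 (L2 l × L2 l))) := by
  have e : (H1 l : Set (WithLp 2 (L2 l × L2 l))) = ⋂ (i : Fin N) (ψ : ℝ → ℝ)
      (_ : IsTestFun (l i) ψ), {p | ∫ x, p.fst i x * deriv ψ x ∂intervalMeasure (l i)
        = -∫ x, p.snd i x * ψ x ∂intervalMeasure (l i)} := by
    ext p
    simp only [mem_iInter]
    rfl
  rw [e]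
  refine isClosed_iInter fun i => isClosed_iInter fun ψ => isClosed_iInter fun hψ => ?_
  have h1 := (continuous_integral_mul (T := l i) (ContinuousLinearMap.id ℝ ℝ)
    hψ.continuous_deriv).comp (((PiLp.proj 2 (𝕜 := ℝ) (fun i => Lp ℝ 2 (intervalMeasure (l i))) i).comp
      (WithLp.fstL 2 ℝ (L2 l) (L2 l))).continuous)
  have h2 := (continuous_integral_mul (T := l i) (ContinuousLinearMap.id ℝ ℝ)
    hψ.smooth.continuous).comp (((PiLp.proj 2 (𝕜 := ℝ) (fun i => Lp ℝ 2 (intervalMeasure (l i))) i).comp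
      (WithLp.sndL 2 ℝ (L2 l) (L2 l))).continuous)
  exact isClosed_eq h1 h2.neg

/-- The functional `∫₀ᵃ (f + (x - c) g) dx`; if `g` is the derivative of `f`, this is the boundary
term `(a - c) f(a) + c f(0)`. Both integrals are pairings of an `L²` function with a continuous one,
so the functional is visibly continuous in `(f, g)`. -/
def boundaryFunctional (a c : ℝ) (f g : ℝ → ℝ) : ℝ :=
  ∫ x, f x * 1 ∂intervalMeasure a + ∫ x, g x * (x - c) ∂intervalMeasure a

theorem boundaryFunctional_eq {a : ℝ} (ha : 0 < a) (c : ℝ) {f g : ℝ → ℝ}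
    (hf : IntegrableOn f (Ioo 0 a)) (hg : IntegrableOn g (Ioo 0 a)) (h : HasWeakDeriv a f g)
    {F : ℝ → ℝ} (hF : ContinuousOn F (Icc 0 a)) (hFf : f =ᵐ[intervalMeasure a] F) :
    boundaryFunctional a c f g = (a - c) * F a + c * F 0 := by
  obtain ⟨k, hk⟩ := (hasWeakDeriv_iff.1 h).exists_ae_eq ha hf hg
  have hG := continuousOn_primitive_Icc ha.le hg
  have heq : EqOn F (fun x => k + ∫ s in (0 : ℝ)..x, g s) (Icc 0 a) := by
    refine eqOn_Icc_of_ae ha hF (continuousOn_const.add hG) ?_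
    filter_upwards [hk, hFf] with x h1 h2
    rw [← h2, h1]
  have h0 := heq (left_mem_Icc.2 ha.le)
  have ha' := heq (right_mem_Icc.2 ha.le)
  simp only [intervalIntegral.integral_same, add_zero] at h0 ha'
  have hib := integral_deriv_smul_primitive hg (ψ := fun x : ℝ => x - c) (by fun_prop)
  have hd : ∀ x, deriv (fun x : ℝ => x - c) x = 1 := fun x => by simp
  simp only [hd, smul_eq_mul, one_mul] at hib
  have hint : ∫ x, f x * 1 ∂intervalMeasure a
      = a * k + ∫ x in Ioo 0 a, ∫ s in (0 : ℝ)..x, g s := by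
    rw [integral_congr_ae (g := fun x => k + ∫ s in (0 : ℝ)..x, g s)
      (by filter_upwards [hk] with x hx; rw [hx, mul_one]),
      integral_add (by simp)
        (hG.integrableOn_Icc.mono_set Ioo_subset_Icc_self)]
    simp [ha.le]
  have hga : ∫ s in (0 : ℝ)..a, g s = ∫ s in Ioo 0 a, g s := by
    rw [intervalIntegral.integral_of_le ha.le, integral_Ioc_eq_integral_Ioo]
  have hcomm : ∫ x, g x * (x - c) ∂intervalMeasure a = ∫ x in Ioo 0 a, (x - c) * g x := by
    simp only [mul_comm]
  rw [boundaryFunctional, hint, hib, hcomm, h0, ha', hga]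
  ring

/-- The vertex conditions as linear equations between continuous functionals. -/
theorem mem_energySubmodule_iff (hl : ∀ i, 0 < l i) (p : WithLp 2 (L2 l × L2 l)) :
    p ∈ energySubmodule l ↔ p ∈ H1 l ∧
      (∀ i j, (l i)⁻¹ * boundaryFunctional (l i) (l i) (p.fst i) (p.snd i)
        = (l j)⁻¹ * boundaryFunctional (l j) (l j) (p.fst j) (p.snd j)) ∧
      ∀ i, boundaryFunctional (l i) 0 (p.fst i) (p.snd i) = 0 := by
  have hi1 : ∀ i, IntegrableOn (p.fst i) (Ioo 0 (l i)) := fun i =>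
    (Lp.memLp (p.fst i)).integrable one_le_two
  have hi2 : ∀ i, IntegrableOn (p.snd i) (Ioo 0 (l i)) := fun i =>
    (Lp.memLp (p.snd i)).integrable one_le_two
  constructor
  · rintro ⟨hp, F, hF, hF0, hFl⟩
    have hb : ∀ i c, boundaryFunctional (l i) c (p.fst i) (p.snd i)
        = (l i - c) * F i (l i) + c * F i 0 := fun i c =>
      boundaryFunctional_eq (hl i) c (hi1 i) (hi2 i) (hp i) (hF i).1 (hF i).2
    refine ⟨hp, fun i j => ?_, fun i => ?_⟩
    · rw [hb, hb, hF0 i j, sub_self, sub_self, zero_mul, zero_mul, zero_add, zero_add,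
        inv_mul_cancel_left₀ (hl i).ne', inv_mul_cancel_left₀ (hl j).ne']
    · rw [hb, hFl, mul_zero, zero_mul, zero_add]
  · rintro ⟨hp, h0, h1⟩
    choose k hk using fun i => (hasWeakDeriv_iff.1 (hp i)).exists_ae_eq (hl i) (hi1 i) (hi2 i)
    let F : Fin N → ℝ → ℝ := fun i x => k i + ∫ s in (0 : ℝ)..x, p.snd i s
    have hF : ∀ i, ContinuousOn (F i) (Icc 0 (l i)) := fun i =>
      continuousOn_const.add (continuousOn_primitive_Icc (hl i).le (hi2 i))
    have hb : ∀ i c, boundaryFunctional (l i) c (p.fst i) (p.snd i)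
        = (l i - c) * F i (l i) + c * F i 0 := fun i c =>
      boundaryFunctional_eq (hl i) c (hi1 i) (hi2 i) (hp i) (hF i) (hk i)
    refine ⟨hp, F, fun i => ⟨hF i, hk i⟩, fun i j => ?_, fun i => ?_⟩
    · have := h0 i j
      rwa [hb, hb, sub_self, sub_self, zero_mul, zero_mul, zero_add, zero_add,
        inv_mul_cancel_left₀ (hl i).ne', inv_mul_cancel_left₀ (hl j).ne'] at this
    · have := h1 i
      rw [hb, sub_zero, zero_mul, add_zero] at this
      exact (mul_eq_zero.1 this).resolve_left (hl i).ne'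

theorem isClosed_energySubmodule (hl : ∀ i, 0 < l i) :
    IsClosed (energySubmodule l : Set (WithLp 2 (L2 l × L2 l))) := by
  have hc : ∀ i c, Continuous fun p : WithLp 2 (L2 l × L2 l) =>
      boundaryFunctional (l i) c (p.fst i) (p.snd i) := fun i c => by
    have h1 := (continuous_integral_mul (T := l i) (ContinuousLinearMap.id ℝ ℝ)
      (continuous_const (y := (1 : ℝ)))).comp
      (((PiLp.proj 2 (𝕜 := ℝ) (fun i => Lp ℝ 2 (intervalMeasure (l i))) i).comp
        (WithLp.fstL 2 ℝ (L2 l) (L2 l))).continuous)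
    have h2 := (continuous_integral_mul (T := l i) (ContinuousLinearMap.id ℝ ℝ)
      (by fun_prop : Continuous fun x : ℝ => x - c)).comp
      (((PiLp.proj 2 (𝕜 := ℝ) (fun i => Lp ℝ 2 (intervalMeasure (l i))) i).comp
        (WithLp.sndL 2 ℝ (L2 l) (L2 l))).continuous)
    exact h1.add h2
  have e : (energySubmodule l : Set (WithLp 2 (L2 l × L2 l))) = (H1 l : Set _) ∩
      ((⋂ (i : Fin N) (j : Fin N),
        {p | (l i)⁻¹ * boundaryFunctional (l i) (l i) (p.fst i) (p.snd i)
          = (l j)⁻¹ * boundaryFunctional (l j) (l j) (p.fst j) (p.snd j)}) ∩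
      ⋂ i : Fin N, {p | boundaryFunctional (l i) 0 (p.fst i) (p.snd i) = 0}) := by
    ext p
    simp only [mem_inter_iff, mem_iInter, mem_ofPred_eq, SetLike.mem_coe]
    exact mem_energySubmodule_iff hl p
  rw [e]
  refine (isClosed_H1 l).inter (IsClosed.inter ?_ ?_)
  · exact isClosed_iInter fun i => isClosed_iInter fun j =>
      isClosed_eq (continuous_const.mul (hc i (l i))) (continuous_const.mul (hc j (l j)))
  · exact isClosed_iInter fun i => isClosed_eq (hc i 0) continuous_const

theorem completeSpace_V (hl : ∀ i, 0 < l i) : CompleteSpace (V l) :=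
  (isClosed_energySubmodule hl).completeSpace_coe

theorem separableSpace_V (l : Fin N → ℝ) : TopologicalSpace.SeparableSpace (V l) := by
  have : Fact ((2 : ℝ≥0∞) ≠ ⊤) := ⟨by simp⟩
  have h1 : SecondCountableTopology (L2 l) := inferInstance
  have h2 : SecondCountableTopology (WithLp 2 (L2 l × L2 l)) :=
    (WithLp.homeomorphProd 2 (L2 l) (L2 l)).secondCountableTopology
  have h3 : SecondCountableTopology (energySubmodule l) :=
    TopologicalSpace.Subtype.secondCountableTopology _
  have h4 : SecondCountableTopology (V l) := h3
  infer_instance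

theorem norm_sq_V (φ : V l) : ‖φ‖ ^ 2 = ‖toL2 φ‖ ^ 2 + ‖dx φ‖ ^ 2 :=
  WithLp.prod_norm_sq_eq_of_L2 φ.1

theorem norm_toL2_le (φ : V l) : ‖toL2 φ‖ ≤ ‖φ‖ :=
  le_of_sq_le_sq (by rw [norm_sq_V]; nlinarith [sq_nonneg ‖dx φ‖]) (norm_nonneg _)

theorem norm_dx_le (φ : V l) : ‖dx φ‖ ≤ ‖φ‖ :=
  le_of_sq_le_sq (by rw [norm_sq_V]; nlinarith [sq_nonneg ‖toL2 φ‖]) (norm_nonneg _)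

/-- A test function on one edge, extended by zero to the star graph, as an element of `V`. -/
theorem exists_edgeFunction (hl : ∀ i, 0 < l i) (i : Fin N) {ψ : ℝ → ℝ} (hψ : IsTestFun (l i) ψ) :
    ∃ φ : V l, (toL2 φ i =ᵐ[intervalMeasure (l i)] ψ) ∧ ∀ k, k ≠ i → toL2 φ k = 0 := by
  have h1 : MemLp ψ 2 (intervalMeasure (l i)) := memLp_of_continuous hψ.smooth.continuous
  have h2 : MemLp (deriv ψ) 2 (intervalMeasure (l i)) := memLp_of_continuous hψ.continuous_deriv
  have hz : ∀ x, x ∉ Ioo 0 (l i) → ψ x = 0 := fun x hx =>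
    image_eq_zero_of_notMem_tsupport fun h => hx (hψ.supp h)
  have hwd : HasWeakDeriv (l i) ψ (deriv ψ) := by
    rw [hasWeakDeriv_iff]
    refine isWeakDerivOn_of_primitive (hl i).le (h2.integrable one_le_two) 0
      (Eventually.of_forall fun x => ?_)
    rw [intervalIntegral.integral_deriv_eq_sub
      (fun x _ => hψ.smooth.differentiable (by simp) x)
      (hψ.continuous_deriv.intervalIntegrable _ _), hz 0 (by simp)]
    simp
  let p : WithLp 2 (L2 l × L2 l) := WithLp.toLp 2
    (PiLp.single 2 i h1.toLp, PiLp.single 2 i h2.toLp)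
  have hpi : p.fst i = h1.toLp := by simp [p]
  have hpi' : p.snd i = h2.toLp := by simp [p]
  have hpk : ∀ k, k ≠ i → p.fst k = 0 := fun k hk => by simp [p, hk]
  have hpk' : ∀ k, k ≠ i → p.snd k = 0 := fun k hk => by simp [p, hk]
  have hp : p ∈ energySubmodule l := by
    refine ⟨fun k χ hχ => ?_, fun k => if k = i then ψ else 0, fun k => ?_,
      fun k m => ?_, fun k => ?_⟩
    · by_cases hk : k = i
      · subst hk
        rw [hpi, hpi', integral_congr_ae (g := fun x => ψ x * deriv χ x)
          (by filter_upwards [h1.coeFn_toLp] with x hx; rw [hx]),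
          integral_congr_ae (f := fun x => (MemLp.toLp (deriv ψ) h2) x * χ x)
            (g := fun x => deriv ψ x * χ x)
          (by filter_upwards [h2.coeFn_toLp] with x hx; rw [hx])]
        exact hwd χ hχ
      · rw [hpk k hk, hpk' k hk, integral_congr_ae (g := fun x => (0 : ℝ))
          (by filter_upwards [Lp.coeFn_zero ℝ 2 (intervalMeasure (l k))] with x hx
              simp only [hx, Pi.zero_apply, zero_mul]),
          integral_congr_ae (f := fun x => (0 : Lp ℝ 2 (intervalMeasure (l k))) x * χ x)
          (g := fun x => (0 : ℝ))
          (by filter_upwards [Lp.coeFn_zero ℝ 2 (intervalMeasure (l k))] with x hx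
              simp only [hx, Pi.zero_apply, zero_mul])]
        simp
    · by_cases hk : k = i
      · subst hk
        simp only [if_true, hpi]
        exact ⟨hψ.smooth.continuous.continuousOn, h1.coeFn_toLp⟩
      · simp only [if_neg hk, hpk k hk]
        exact ⟨continuousOn_const, Lp.coeFn_zero ℝ 2 _⟩
    · have h0 : ∀ k, (if k = i then ψ else 0) (0 : ℝ) = 0 := fun k => by
        split_ifs
        · exact hz 0 (by simp)
        · rfl
      exact (h0 k).trans (h0 m).symm
    · by_cases hk : k = i
      · subst hk
        simpa using hz (l k) (by simp)
      · simp [hk]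
  refine ⟨⟨p, hp⟩, ?_, fun k hk => hpk k hk⟩
  have : toL2 (l := l) ⟨p, hp⟩ i = h1.toLp := hpi
  rw [this]
  exact h1.coeFn_toLp

/-- `V` is dense in `∏ L²(0, lᵢ)`, since it contains the test functions on each edge. -/
theorem denseRange_toL2 (hl : ∀ i, 0 < l i) : DenseRange (toL2 (l := l)) := by
  have hd : Dense ((toL2 (l := l)).range : Set (L2 l)) := by
    rw [Submodule.dense_iff_topologicalClosure_eq_top, Submodule.topologicalClosure_eq_top_iff,
      Submodule.eq_bot_iff]
    intro f hf
    rw [Submodule.mem_orthogonal] at hf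
    refine PiLp.ext fun i => ?_
    refine Lp.ext ?_
    have h0 := ae_eq_zero_of_test (F := ℝ) (f := fun x => f i x)
      ((Lp.memLp (f i)).integrable one_le_two)
      fun ψ h1 h2 h3 => ?_
    · filter_upwards [h0, Lp.coeFn_zero ℝ 2 (intervalMeasure (l i))] with x hx hx'
      rw [hx]
      exact hx'.symm
    · obtain ⟨φ, hφ, hφ'⟩ := exists_edgeFunction hl i ⟨h1, h2, h3⟩
      have := hf (toL2 φ) ⟨φ, rfl⟩
      rw [PiLp.inner_apply, Finset.sum_eq_single i (fun k _ hk => by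
        rw [hφ' k hk, inner_zero_left]) (by simp), L2.inner_def] at this
      refine Eq.trans ?_ this
      refine integral_congr_ae ?_
      filter_upwards [hφ] with x hx
      rw [hx]
      simp [mul_comm]
  exact hd

end EnergySpace

/-! ### The bilinear form of the star graph -/

section Forms

variable {N : ℕ} {l : Fin N → ℝ} {T : ℝ}

/-- The times at which every `uᵢ(·, t)` is bounded by `‖u‖`. -/
def IsGoodTime (u : LInf l T) (t : ℝ) : Prop :=
  ∀ i, ∀ᵐ x ∂intervalMeasure (l i), ‖u i (x, t)‖ ≤ ‖u‖

theorem ae_isGoodTime (u : LInf l T) : ∀ᵐ t ∂intervalMeasure T, IsGoodTime u t := by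
  refine ae_all_iff.2 fun i => ?_
  have h1 : ∀ᵐ p ∂(intervalMeasure (l i)).prod (intervalMeasure T), ‖u i p‖ ≤ ‖u‖ := by
    have h0 : rectMeasure (l i) T = (intervalMeasure (l i)).prod (intervalMeasure T) := by
      rw [Measure.prod_restrict]; rfl
    rw [← h0]
    have h2 : ∀ᵐ p ∂rectMeasure (l i) T, ‖u i p‖ ≤ ‖u i‖ := by
      filter_upwards [ae_le_eLpNormEssSup (f := u i) (μ := rectMeasure (l i) T)] with p hp
      rw [← eLpNorm_exponent_top] at hp
      rw [Lp.norm_def, ← toReal_enorm]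
      exact ENNReal.toReal_mono (Lp.eLpNorm_ne_top _) hp
    filter_upwards [h2] with p hp
    exact hp.trans (PiLp.norm_apply_le u i)
  have h2 := (Measure.measurePreserving_swap (μ := intervalMeasure T)
    (ν := intervalMeasure (l i))).quasiMeasurePreserving.ae h1
  exact Measure.ae_ae_of_ae_prod h2

theorem sum_norm_mul_norm_le (f g : L2 l) : ∑ i, ‖f i‖ * ‖g i‖ ≤ ‖f‖ * ‖g‖ := by
  refine le_of_sq_le_sq ?_ (by positivity)
  rw [mul_pow, PiLp.norm_sq_eq_of_L2, PiLp.norm_sq_eq_of_L2]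
  exact Finset.sum_mul_sq_le_sq_mul_sq _ _ _

/-- At a good time the bilinear form is expressed by inner products in `L²(0, lᵢ)`, with `M i` the
multiplication by `uᵢ(·, t)`. -/
theorem exists_form_repr (D : Fin N → ℝ) {u : LInf l T} {t : ℝ} (h : IsGoodTime u t) :
    ∃ M : ∀ i, Lp ℝ 2 (intervalMeasure (l i)) →L[ℝ] Lp ℝ 2 (intervalMeasure (l i)),
      (∀ i f, ‖M i f‖ ≤ ‖u‖ * ‖f‖) ∧ ∀ φ χ : V l, form D u t φ χ
        = ∑ i, (D i * inner ℝ (dx φ i) (dx χ i) + inner ℝ (M i (toL2 φ i)) (dx χ i)) := by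
  have hm : ∀ i, StronglyMeasurable fun x => u i (x, t) := fun i =>
    (Lp.stronglyMeasurable (u i)).comp_measurable (by fun_prop)
  choose M hM using fun i => exists_mulOperator (F := ℝ) (hm i).aestronglyMeasurable (h i)
  refine ⟨M, fun i f => ?_, fun φ χ => ?_⟩
  · refine Lp.norm_le_mul_norm_of_ae_le_mul ?_
    filter_upwards [hM i f, h i] with x h1 h2
    rw [h1, norm_smul]
    exact mul_le_mul_of_nonneg_right h2 (norm_nonneg _)
  · refine Finset.sum_congr rfl fun i _ => ?_
    rw [← real_inner_smul_left, ← inner_add_left, L2.inner_def]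
    refine integral_congr_ae ?_
    filter_upwards [hM i (toL2 φ i), Lp.coeFn_add (D i • dx φ i) (M i (toL2 φ i)),
      Lp.coeFn_smul (D i) (dx φ i)] with x h1 h2 h3
    rw [h2, Pi.add_apply, h1, h3, Pi.smul_apply, smul_eq_mul, smul_eq_mul]
    simp [mul_comm]

theorem abs_form_le {D : Fin N → ℝ} {Dmax : ℝ} (hD : ∀ i, |D i| ≤ Dmax) {u : LInf l T} {t : ℝ}
    (h : IsGoodTime u t) (φ χ : V l) : |form D u t φ χ| ≤ (|Dmax| + ‖u‖) * ‖φ‖ * ‖χ‖ := by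
  obtain ⟨M, hM, hform⟩ := exists_form_repr D h
  rw [hform]
  have hterm : ∀ i, |D i * inner ℝ (dx φ i) (dx χ i) + inner ℝ (M i (toL2 φ i)) (dx χ i)|
      ≤ |Dmax| * (‖dx φ i‖ * ‖dx χ i‖) + ‖u‖ * (‖toL2 φ i‖ * ‖dx χ i‖) := fun i => by
    refine (abs_add_le _ _).trans (add_le_add ?_ ?_)
    · rw [abs_mul]
      exact mul_le_mul ((hD i).trans (le_abs_self _)) (abs_real_inner_le_norm _ _) (abs_nonneg _)
        (abs_nonneg _)
    · refine (abs_real_inner_le_norm _ _).trans ?_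
      rw [← mul_assoc]
      exact mul_le_mul_of_nonneg_right (hM i _) (norm_nonneg _)
  have h1 : ‖dx φ‖ * ‖dx χ‖ ≤ ‖φ‖ * ‖χ‖ :=
    mul_le_mul (norm_dx_le φ) (norm_dx_le χ) (norm_nonneg _) (norm_nonneg _)
  have h2 : ‖toL2 φ‖ * ‖dx χ‖ ≤ ‖φ‖ * ‖χ‖ :=
    mul_le_mul (norm_toL2_le φ) (norm_dx_le χ) (norm_nonneg _) (norm_nonneg _)
  calc _ ≤ ∑ i, (|Dmax| * (‖dx φ i‖ * ‖dx χ i‖) + ‖u‖ * (‖toL2 φ i‖ * ‖dx χ i‖)) :=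
        (Finset.abs_sum_le_sum_abs _ _).trans (Finset.sum_le_sum fun i _ => hterm i)
    _ = |Dmax| * ∑ i, ‖dx φ i‖ * ‖dx χ i‖ + ‖u‖ * ∑ i, ‖toL2 φ i‖ * ‖dx χ i‖ := by
        rw [Finset.sum_add_distrib, Finset.mul_sum, Finset.mul_sum]
    _ ≤ |Dmax| * (‖φ‖ * ‖χ‖) + ‖u‖ * (‖φ‖ * ‖χ‖) :=
        add_le_add
          (mul_le_mul_of_nonneg_left ((sum_norm_mul_norm_le _ _).trans h1) (abs_nonneg _))
          (mul_le_mul_of_nonneg_left ((sum_norm_mul_norm_le _ _).trans h2) (norm_nonneg _))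
    _ = _ := by ring

/-- Gårding's inequality: the drift term is absorbed by Young's inequality. -/
theorem garding_form {D : Fin N → ℝ} {Dmin : ℝ} (hD0 : 0 < Dmin) (hD : ∀ i, Dmin ≤ D i)
    {u : LInf l T} {t : ℝ} (h : IsGoodTime u t) (φ : V l) :
    Dmin / 2 * ‖φ‖ ^ 2
      ≤ form D u t φ φ + (‖u‖ ^ 2 / (2 * Dmin) + Dmin / 2) * ‖toL2 φ‖ ^ 2 := by
  obtain ⟨M, hM, hform⟩ := exists_form_repr D h
  have hterm : ∀ i, Dmin * ‖dx φ i‖ ^ 2 - ‖u‖ * (‖toL2 φ i‖ * ‖dx φ i‖)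
      ≤ D i * inner ℝ (dx φ i) (dx φ i) + inner ℝ (M i (toL2 φ i)) (dx φ i) := fun i => by
    have h1 : -(‖u‖ * (‖toL2 φ i‖ * ‖dx φ i‖)) ≤ inner ℝ (M i (toL2 φ i)) (dx φ i) := by
      refine neg_le_of_abs_le ((abs_real_inner_le_norm _ _).trans ?_)
      rw [← mul_assoc]
      exact mul_le_mul_of_nonneg_right (hM i _) (norm_nonneg _)
    have h2 := mul_le_mul_of_nonneg_right (hD i) (sq_nonneg ‖dx φ i‖)
    rw [real_inner_self_eq_norm_sq]
    linarith
  have hsum := Finset.sum_le_sum fun i (_ : i ∈ Finset.univ) => hterm i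
  rw [← hform, Finset.sum_sub_distrib, ← Finset.mul_sum, ← Finset.mul_sum,
    ← PiLp.norm_sq_eq_of_L2] at hsum
  have h3 := mul_le_mul_of_nonneg_left (sum_norm_mul_norm_le (toL2 φ) (dx φ)) (norm_nonneg u)
  have h4 : 0 ≤ (2 * Dmin)⁻¹ * (Dmin * ‖dx φ‖ - ‖u‖ * ‖toL2 φ‖) ^ 2 := by positivity
  have h5 : (2 * Dmin)⁻¹ * (Dmin * ‖dx φ‖ - ‖u‖ * ‖toL2 φ‖) ^ 2
      = Dmin / 2 * ‖dx φ‖ ^ 2 - ‖u‖ * (‖toL2 φ‖ * ‖dx φ‖)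
        + ‖u‖ ^ 2 / (2 * Dmin) * ‖toL2 φ‖ ^ 2 := by
    field_simp
    ring
  rw [norm_sq_V]
  linarith

theorem exists_formOp (D : Fin N → ℝ) {u : LInf l T} {t : ℝ} (h : IsGoodTime u t) :
    ∃ a : V l →L[ℝ] StrongDual ℝ (V l), ∀ φ χ, a φ χ = form D u t φ χ := by
  obtain ⟨M, -, hform⟩ := exists_form_repr D h
  let P : ∀ i, L2 l →L[ℝ] Lp ℝ 2 (intervalMeasure (l i)) := fun i =>
    PiLp.proj 2 (𝕜 := ℝ) (fun i => Lp ℝ 2 (intervalMeasure (l i))) i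
  let S : ∀ i, V l →L[ℝ] Lp ℝ 2 (intervalMeasure (l i)) := fun i =>
    D i • (P i).comp dx + (M i).comp ((P i).comp toL2)
  refine ⟨∑ i, (innerSL ℝ).bilinearComp (S i) ((P i).comp dx), fun φ χ => ?_⟩
  rw [hform]
  simp only [sum_apply]
  refine Finset.sum_congr rfl fun i _ => ?_
  change inner ℝ (D i • dx φ i + M i (toL2 φ i)) (dx χ i) = _
  rw [inner_add_left, real_inner_smul_left]

open Classical in
/-- The operator `V → V*` of the bilinear form at time `t`; it is set to zero on the null set of
times at which `u(·, t)` is not bounded by `‖u‖`. -/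
def formOp (D : Fin N → ℝ) (u : LInf l T) (t : ℝ) : V l →L[ℝ] StrongDual ℝ (V l) :=
  if h : IsGoodTime u t then (exists_formOp D h).choose else 0

theorem formOp_apply (D : Fin N → ℝ) {u : LInf l T} {t : ℝ} (h : IsGoodTime u t) (φ χ : V l) :
    formOp D u t φ χ = form D u t φ χ := by
  rw [formOp, dif_pos h]
  exact (exists_formOp D h).choose_spec φ χ

theorem norm_formOp_apply_le {D : Fin N → ℝ} {Dmax : ℝ} (hD : ∀ i, |D i| ≤ Dmax) (u : LInf l T)
    (t : ℝ) (φ : V l) : ‖formOp D u t φ‖ ≤ (|Dmax| + ‖u‖) * ‖φ‖ := by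
  by_cases h : IsGoodTime u t
  · refine ContinuousLinearMap.opNorm_le_bound _ (by positivity) fun χ => ?_
    rw [formOp_apply D h]
    exact abs_form_le hD h φ χ
  · rw [formOp, dif_neg h]
    simp only [zero_apply, norm_zero]
    positivity

/-- The transpose has the same bound. It is the transpose that acts in the adjoint equation. -/
theorem norm_formOp_flip_apply_le {D : Fin N → ℝ} {Dmax : ℝ} (hD : ∀ i, |D i| ≤ Dmax)
    (u : LInf l T) (t : ℝ) (φ : V l) : ‖(formOp D u t).flip φ‖ ≤ (|Dmax| + ‖u‖) * ‖φ‖ := by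
  refine ContinuousLinearMap.opNorm_le_bound _ (by positivity) fun χ => ?_
  rw [ContinuousLinearMap.flip_apply]
  refine ((formOp D u t χ).le_opNorm φ).trans ?_
  have := mul_le_mul_of_nonneg_right (norm_formOp_apply_le hD u t χ) (norm_nonneg φ)
  linarith

/-- The form is an integral in `x` of a jointly measurable function of `(x, t)`. -/
theorem stronglyMeasurable_form (D : Fin N → ℝ) (u : LInf l T) (φ χ : V l) :
    StronglyMeasurable fun t => form D u t φ χ := by
  refine Finset.stronglyMeasurable_fun_sum _ fun i _ => ?_
  refine StronglyMeasurable.integral_prod_left'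
    (f := fun p : ℝ × ℝ => (D i * dx φ i p.1 + u i (p.1, p.2) * toL2 φ i p.1) * dx χ i p.1) ?_
  have hfst : Measurable (Prod.fst : ℝ × ℝ → ℝ) := measurable_fst
  have h1 := (Lp.stronglyMeasurable (dx φ i)).comp_measurable hfst
  have h2 := (Lp.stronglyMeasurable (toL2 φ i)).comp_measurable hfst
  have h3 := (Lp.stronglyMeasurable (dx χ i)).comp_measurable hfst
  exact ((stronglyMeasurable_const.mul h1).add ((Lp.stronglyMeasurable (u i)).mul h2)).mul h3

theorem aestronglyMeasurable_formOp (D : Fin N → ℝ) (u : LInf l T) (φ χ : V l) :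
    AEStronglyMeasurable (fun t => formOp D u t φ χ) (intervalMeasure T) := by
  refine (stronglyMeasurable_form D u φ χ).aestronglyMeasurable.congr ?_
  filter_upwards [ae_isGoodTime u] with t ht
  rw [formOp_apply D ht]

theorem isGarding_formOp {D : Fin N → ℝ} {Dmin : ℝ} (hD0 : 0 < Dmin) (hD : ∀ i, Dmin ≤ D i)
    (u : LInf l T) :
    IsGarding toL2 T (Dmin / 2) (‖u‖ ^ 2 / (2 * Dmin) + Dmin / 2) (formOp D u) := by
  filter_upwards [ae_isGoodTime u] with t ht φ
  rw [formOp_apply D ht]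
  exact garding_form hD0 hD ht φ

end Forms

/-! ### The norm of a backward solution -/

section Bounds

variable {E H : Type*} [NormedAddCommGroup E] [InnerProductSpace ℝ E]
  [NormedAddCommGroup H] [InnerProductSpace ℝ H] {j : E →L[ℝ] H} {T : ℝ}
  {A : Lp E 2 (intervalMeasure T) →L[ℝ] Lp (StrongDual ℝ E) 2 (intervalMeasure T)}
  {a : ℝ → E →L[ℝ] StrongDual ℝ E} {α κ B : ℝ}

theorem norm_evolutionSpace_le (w : EvolutionSpace j T) : ‖w‖ ≤ ‖w.1.fst‖ + ‖w.1.snd‖ := by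
  refine le_of_sq_le_sq ?_ (by positivity)
  have h : ‖w‖ ^ 2 = ‖w.1.fst‖ ^ 2 + ‖w.1.snd‖ ^ 2 := WithLp.prod_norm_sq_eq_of_L2 w.1
  rw [h]
  nlinarith [mul_nonneg (norm_nonneg w.1.fst) (norm_nonneg w.1.snd)]

/-- The a priori bound in `W(0,T)`: the energy estimate bounds `w`, the equation bounds `∂ₜw`. -/
theorem IsBackwardSolution.norm_le (hT : 0 < T) (hκ : 0 ≤ κ) (hα : 0 < α)
    (ha : IsGarding j T α κ a) (hA : ∀ f, ∀ᵐ t ∂intervalMeasure T, A f t = a t (f t))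
    (hB : ∀ f, ‖A f‖ ≤ B * ‖f‖) (hB0 : 0 ≤ B)
    {F : Lp (StrongDual ℝ E) 2 (intervalMeasure T)} {g : H}
    {w : EvolutionSpace j T} {Q : ℝ → H} (h : IsBackwardSolution j A F g w Q) :
    ‖w‖ ≤ (1 + B) * (Real.exp (κ * T) * √(α⁻¹) * (‖g‖ + √(α⁻¹) * ‖F‖)) + ‖F‖ := by
  have hs : √(α⁻¹) ^ 2 = α⁻¹ := Real.sq_sqrt (inv_pos.2 hα).le
  have he : Real.exp (2 * κ * T) = Real.exp (κ * T) ^ 2 := by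
    rw [← Real.exp_nat_mul]; congr 1; push_cast; ring
  have h1 := h.norm_fst_sq_le hT hκ hα ha hA
  have hfst : ‖w.1.fst‖ ≤ Real.exp (κ * T) * √(α⁻¹) * (‖g‖ + √(α⁻¹) * ‖F‖) := by
    refine le_of_sq_le_sq ?_ (by positivity)
    have h2 : ‖w.1.fst‖ ^ 2 ≤ α⁻¹ * (Real.exp (2 * κ * T) * (‖g‖ ^ 2 + α⁻¹ * ‖F‖ ^ 2)) := by
      rw [← div_eq_inv_mul, le_div_iff₀ hα, mul_comm]
      exact h1
    have h3 : ‖g‖ ^ 2 + α⁻¹ * ‖F‖ ^ 2 ≤ (‖g‖ + √(α⁻¹) * ‖F‖) ^ 2 := by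
      have : 0 ≤ ‖g‖ * (√(α⁻¹) * ‖F‖) := by positivity
      have hF : α⁻¹ * ‖F‖ ^ 2 = (√(α⁻¹) * ‖F‖) ^ 2 := by rw [mul_pow, hs]
      linarith [add_sq ‖g‖ (√(α⁻¹) * ‖F‖)]
    calc ‖w.1.fst‖ ^ 2 ≤ α⁻¹ * (Real.exp (2 * κ * T) * (‖g‖ + √(α⁻¹) * ‖F‖) ^ 2) :=
          h2.trans (mul_le_mul_of_nonneg_left
            (mul_le_mul_of_nonneg_left h3 (Real.exp_pos _).le) (inv_pos.2 hα).le)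
      _ = _ := by rw [he, mul_pow _ (‖g‖ + _), mul_pow, hs]; ring
  have hsnd : ‖w.1.snd‖ ≤ B * ‖w.1.fst‖ + ‖F‖ := by
    have e : w.1.snd = A w.1.fst - F := by rw [← h.equation]; abel
    rw [e]
    exact (norm_sub_le _ _).trans (add_le_add_left (hB _) _)
  have h4 := norm_evolutionSpace_le w
  have h5 := mul_le_mul_of_nonneg_left hfst (by linarith : 0 ≤ 1 + B)
  linarith

end Bounds

/-! ### The adjoint equation on the star graph -/

section Adjoint

variable {N : ℕ} {l : Fin N → ℝ} {T : ℝ}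

/-- The embedding of `∏ L²(0, lᵢ)` into `V*`. -/
def toDualV (l : Fin N → ℝ) : L2 l →L[ℝ] StrongDual ℝ (V l) :=
  (innerSL ℝ).bilinearComp (ContinuousLinearMap.id ℝ (L2 l)) toL2

theorem toDualV_apply (h : L2 l) (φ : V l) : toDualV l h φ = inner ℝ h (toL2 φ) := rfl

theorem norm_toDualV_le (h : L2 l) : ‖toDualV l h‖ ≤ ‖h‖ :=
  ContinuousLinearMap.opNorm_le_bound _ (norm_nonneg _) fun φ => by
    rw [toDualV_apply]
    exact (norm_inner_le_norm _ _).trans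
      (mul_le_mul_of_nonneg_left (norm_toL2_le φ) (norm_nonneg _))

/-- The right-hand side `⟨ρ - ρᵈ, ·⟩` of the adjoint equation in `L²(0,T;V*)`. -/
def adjointSource (ρ : W l T) (ρd : Lp (L2 l) 2 (intervalMeasure T)) :
    Lp (StrongDual ℝ (V l)) 2 (intervalMeasure T) :=
  (toDualV l).compLp ((toL2 (l := l)).compLp (W.fn ρ) - ρd)

theorem adjointSource_ae (ρ : W l T) (ρd : Lp (L2 l) 2 (intervalMeasure T)) :
    ∀ᵐ t ∂intervalMeasure T, adjointSource ρ ρd t = toDualV l (toL2 (W.fn ρ t) - ρd t) := by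
  filter_upwards [(toDualV l).coeFn_compLp ((toL2 (l := l)).compLp (W.fn ρ) - ρd),
    Lp.coeFn_sub ((toL2 (l := l)).compLp (W.fn ρ)) ρd, (toL2 (l := l)).coeFn_compLp (W.fn ρ)]
    with t h1 h2 h3
  rw [adjointSource, h1, h2, Pi.sub_apply, h3]

theorem norm_adjointSource_le (ρ : W l T) (ρd : Lp (L2 l) 2 (intervalMeasure T)) :
    ‖adjointSource ρ ρd‖ ≤ ‖W.fn ρ‖ + ‖ρd‖ := by
  have h1 : ‖adjointSource ρ ρd‖ ≤ ‖(toL2 (l := l)).compLp (W.fn ρ) - ρd‖ := by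
    refine Lp.norm_le_norm_of_ae_le ?_
    filter_upwards [(toDualV l).coeFn_compLp ((toL2 (l := l)).compLp (W.fn ρ) - ρd)] with t ht
    rw [adjointSource, ht]
    exact norm_toDualV_le _
  have h2 : ‖(toL2 (l := l)).compLp (W.fn ρ)‖ ≤ ‖W.fn ρ‖ := by
    refine Lp.norm_le_norm_of_ae_le ?_
    filter_upwards [(toL2 (l := l)).coeFn_compLp (W.fn ρ)] with t ht
    rw [ht]
    exact norm_toL2_le _
  exact h1.trans ((norm_sub_le _ _).trans (add_le_add_left h2 _))

theorem IsContRep.eqOn (hT : 0 < T) {w : W l T} {R R' : ℝ → L2 l} (h : IsContRep w R)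
    (h' : IsContRep w R') : EqOn R R' (Icc 0 T) := by
  refine eqOn_Icc_of_ae hT h.continuousOn h'.continuousOn ?_
  filter_upwards [h.ae_eq, h'.ae_eq] with t h1 h2
  rw [h1, h2]

/-- The adjoint problem as an abstract backward problem, for an operator `A` on `L²(0,T;V)` that
acts as the transpose of the bilinear form. -/
theorem isAdjointSolution_iff (hT : 0 < T) {D : Fin N → ℝ} {u : LInf l T} {ρ : W l T}
    {R : ℝ → L2 l} (hR : IsContRep ρ R) {ρd : Lp (L2 l) 2 (intervalMeasure T)} {ρT : L2 l}
    {A : Lp (V l) 2 (intervalMeasure T) →L[ℝ] Lp (StrongDual ℝ (V l)) 2 (intervalMeasure T)}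
    (hA : ∀ f, ∀ᵐ t ∂intervalMeasure T, A f t = (formOp D u t).flip (f t)) {q : W l T} :
    IsAdjointSolution D u ρ ρd ρT q ↔
      ∃ Q, IsBackwardSolution toL2 A (adjointSource ρ ρd) (R T - ρT) q Q := by
  constructor
  · rintro ⟨heq, R', Q, hR', hQ, hQT⟩
    refine ⟨Q, hQ.continuousOn, hQ.ae_eq, ?_, ?_⟩
    · refine Lp.ext ?_
      filter_upwards [heq, hA q.1.fst, Lp.coeFn_add (-q.1.snd) (A q.1.fst), Lp.coeFn_neg q.1.snd,
        adjointSource_ae ρ ρd, ae_isGoodTime u] with t h1 h2 h3 h4 h5 h6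
      ext φ
      rw [h3, Pi.add_apply, h4, Pi.neg_apply, h2, h5, toDualV_apply, ← h1 φ, add_apply, neg_apply,
        ContinuousLinearMap.flip_apply, formOp_apply D h6]
      rfl
    · rw [hQT, hR.eqOn hT hR' (right_mem_Icc.2 hT.le)]
  · rintro ⟨Q, h⟩
    refine ⟨?_, R, Q, hR, ⟨h.continuousOn, h.ae_eq⟩, h.terminal⟩
    filter_upwards [h.ae_equation (a := fun t => (formOp D u t).flip) hA, adjointSource_ae ρ ρd,
      ae_isGoodTime u] with t h1 h2 h3 φ
    have h4 := DFunLike.congr_fun (h1.trans h2) φ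
    rw [toDualV_apply, add_apply, neg_apply, ContinuousLinearMap.flip_apply,
      formOp_apply D h3] at h4
    exact h4

/-- The constant in the a priori estimate, built from the Gårding constants `α = D_min / 2` and
`κ = M² / (2 D_min) + D_min / 2` and the bound `D_max + M` of the bilinear form. -/
def adjointConst (T Dmin Dmax M : ℝ) : ℝ :=
  (1 + (|Dmax| + |M|)) *
    (Real.exp ((M ^ 2 / (2 * Dmin) + Dmin / 2) * T) * √((Dmin / 2)⁻¹) *
      ((Real.exp ((M ^ 2 / (2 * Dmin) + Dmin / 2) * T) + 1) + √((Dmin / 2)⁻¹) *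
        (Real.exp ((M ^ 2 / (2 * Dmin) + Dmin / 2) * T) * √((Dmin / 2)⁻¹) + 1)))
  + (Real.exp ((M ^ 2 / (2 * Dmin) + Dmin / 2) * T) * √((Dmin / 2)⁻¹) + 1)

theorem adjointConst_pos (T Dmin Dmax M : ℝ) : 0 < adjointConst T Dmin Dmax M := by
  unfold adjointConst
  positivity

theorem continuous_adjointConst (T Dmin Dmax : ℝ) : Continuous (adjointConst T Dmin Dmax) := by
  unfold adjointConst
  fun_prop

/-- A priori bounds for the state: its final value and its norm in `L²(0,T;V)` are controlled by
the initial value. -/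
theorem state_bounds (hT : 0 < T) {D : Fin N → ℝ} {Dmin : ℝ} (hD0 : 0 < Dmin)
    (hD : ∀ i, Dmin ≤ D i) {u : LInf l T} {ρ0 : L2 l} {ρ : W l T}
    (h : IsStateSolution D u ρ0 ρ) {R : ℝ → L2 l} (hR : IsContRep ρ R) (hR0 : R 0 = ρ0) :
    ‖R T‖ ≤ Real.exp ((‖u‖ ^ 2 / (2 * Dmin) + Dmin / 2) * T) * ‖ρ0‖ ∧
      ‖W.fn ρ‖ ≤ Real.exp ((‖u‖ ^ 2 / (2 * Dmin) + Dmin / 2) * T) * √((Dmin / 2)⁻¹) * ‖ρ0‖ := by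
  set κ := ‖u‖ ^ 2 / (2 * Dmin) + Dmin / 2 with hκ
  have hα : 0 < Dmin / 2 := by linarith
  have heq : ∀ᵐ t ∂intervalMeasure T, ρ.1.snd t = -formOp D u t (ρ.1.fst t) := by
    filter_upwards [h.equation, ae_isGoodTime u] with t h1 h2
    ext φ
    rw [neg_apply, formOp_apply D h2]
    exact eq_neg_of_add_eq_zero_left (h1 φ)
  have hest := forward_estimate hT (by positivity : 0 ≤ κ) hα.le (isGarding_formOp hD0 hD u) ρ heq
    hR.continuousOn hR.ae_eq
  have he : Real.exp (2 * κ * T) = Real.exp (κ * T) ^ 2 := by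
    rw [← Real.exp_nat_mul]; congr 1; push_cast; ring
  rw [hR0, he] at hest
  have hfn : ρ.1.fst = W.fn ρ := rfl
  rw [hfn] at hest
  constructor
  · refine le_of_sq_le_sq ?_ (by positivity)
    rw [mul_pow]
    have : 0 ≤ 2 * (Dmin / 2) * ‖W.fn ρ‖ ^ 2 := by positivity
    linarith
  · refine le_of_sq_le_sq ?_ (by positivity)
    rw [mul_pow, mul_pow, Real.sq_sqrt (inv_pos.2 hα).le]
    have h1 : Dmin / 2 * ‖W.fn ρ‖ ^ 2 ≤ Real.exp (κ * T) ^ 2 * ‖ρ0‖ ^ 2 := by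
      have : 0 ≤ Dmin / 2 * ‖W.fn ρ‖ ^ 2 := by positivity
      nlinarith [sq_nonneg ‖R T‖]
    have h2 := mul_le_mul_of_nonneg_left h1 (inv_pos.2 hα).le
    rw [inv_mul_cancel_left₀ hα.ne'] at h2
    linarith

end Adjoint

end StarGraph

end

theorem proposition4p5 :
    ∃ C : ℝ → ℝ → ℝ → ℝ → ℝ,
      (∀ T Dmin Dmax M, 0 < C T Dmin Dmax M) ∧
      (∀ T Dmin Dmax, Continuous (C T Dmin Dmax)) ∧
      ∀ (N : ℕ) (_ : 0 < N) (l D : Fin N → ℝ) (_ : ∀ i, 0 < l i) (_ : ∀ i, 0 < D i)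
        (T : ℝ) (_ : 0 < T)
        (u : StarGraph.LInf l T) (ρ0 : StarGraph.L2 l)
        (ρd : Lp (StarGraph.L2 l) 2 (StarGraph.intervalMeasure T)) (ρT : StarGraph.L2 l)
        (ρ : StarGraph.W l T),
        StarGraph.IsStateSolution D u ρ0 ρ →
          (∃! q : StarGraph.W l T, StarGraph.IsAdjointSolution D u ρ ρd ρT q) ∧
          ∀ q : StarGraph.W l T, StarGraph.IsAdjointSolution D u ρ ρd ρT q →
            ‖q‖ ≤ C T (⨅ i, D i) (⨆ i, D i) ‖u‖ * (‖ρ0‖ + ‖ρd‖ + ‖ρT‖) := by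
  refine ⟨StarGraph.adjointConst, StarGraph.adjointConst_pos, StarGraph.continuous_adjointConst,
    fun N hN l D hl hD T hT u ρ0 ρd ρT ρ hρ => ?_⟩
  have : Nonempty (Fin N) := ⟨⟨0, hN⟩⟩
  have : CompleteSpace (StarGraph.V l) := StarGraph.completeSpace_V hl
  have : TopologicalSpace.SeparableSpace (StarGraph.V l) := StarGraph.separableSpace_V l
  set Dmin := ⨅ i, D i with hDmin
  set Dmax := ⨆ i, D i with hDmax
  have hmin : ∀ i, Dmin ≤ D i := fun i => ciInf_le (Set.finite_range D).bddBelow i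
  have hmin0 : 0 < Dmin := by
    obtain ⟨i, hi⟩ := exists_eq_ciInf_of_finite (f := D)
    rw [hDmin, ← hi]
    exact hD i
  have hmax : ∀ i, |D i| ≤ Dmax := fun i => by
    rw [abs_of_pos (hD i)]
    exact le_ciSup (Set.finite_range D).bddAbove i
  have hα : 0 < Dmin / 2 := by linarith
  have hκ : 0 ≤ ‖u‖ ^ 2 / (2 * Dmin) + Dmin / 2 := by positivity
  have hB : 0 ≤ |Dmax| + ‖u‖ := by positivity
  -- the form and its transpose as operators from `L²(0,T;V)` to `L²(0,T;V*)`
  obtain ⟨A', hA', -⟩ := StarGraph.exists_lpOperator (μ := StarGraph.intervalMeasure T)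
    (StarGraph.norm_formOp_apply_le hmax u) (StarGraph.aestronglyMeasurable_formOp D u)
  obtain ⟨A, hA, hAB⟩ := StarGraph.exists_lpOperator (μ := StarGraph.intervalMeasure T)
    (StarGraph.norm_formOp_flip_apply_le hmax u)
    fun φ χ => StarGraph.aestronglyMeasurable_formOp D u χ φ
  have hG : StarGraph.IsGarding StarGraph.toL2 T (Dmin / 2) (‖u‖ ^ 2 / (2 * Dmin) + Dmin / 2)
      fun t => (StarGraph.formOp D u t).flip := StarGraph.isGarding_formOp hmin0 hmin u
  obtain ⟨R, hR, hR0⟩ := hρ.initial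
  have hiff := fun q => StarGraph.isAdjointSolution_iff hT (D := D) (u := u) hR (ρd := ρd)
    (ρT := ρT) hA (q := q)
  refine ⟨?_, fun q hq => ?_⟩
  · obtain ⟨q, Q, hq⟩ := StarGraph.exists_isBackwardSolution hT hκ hα hG
      (StarGraph.denseRange_toL2 hl) hA hA' (StarGraph.adjointSource ρ ρd) (R T - ρT)
    refine ⟨q, (hiff q).2 ⟨Q, hq⟩, fun q' hq' => ?_⟩
    -- the difference of two solutions solves the homogeneous problem
    obtain ⟨Q', hq'⟩ := (hiff q').1 hq'
    have := (hq'.sub hq).norm_le hT hκ hα hG hA hAB hB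
    simp only [sub_self, norm_zero, mul_zero, add_zero] at this
    exact sub_eq_zero.1 (norm_le_zero_iff.1 this)
  · obtain ⟨Q, hq⟩ := (hiff q).1 hq
    have h1 := hq.norm_le hT hκ hα hG hA hAB hB
    obtain ⟨h2, h3⟩ := StarGraph.state_bounds hT hmin0 hmin hρ hR hR0
    have h4 := StarGraph.norm_adjointSource_le ρ ρd
    have h5 : ‖R T - ρT‖ ≤ ‖R T‖ + ‖ρT‖ := norm_sub_le _ _
    rw [StarGraph.adjointConst, abs_of_nonneg (norm_nonneg u)]
    set e := Real.exp ((‖u‖ ^ 2 / (2 * Dmin) + Dmin / 2) * T)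
    set s := √((Dmin / 2)⁻¹)
    set S := ‖ρ0‖ + ‖ρd‖ + ‖ρT‖ with hS
    have he : 0 < e := Real.exp_pos _
    have hs : 0 ≤ s := Real.sqrt_nonneg _
    have n0 := norm_nonneg ρ0
    have nd := norm_nonneg ρd
    have nT := norm_nonneg ρT
    have hF : ‖StarGraph.adjointSource ρ ρd‖ ≤ (e * s + 1) * S := by
      have : e * s * ‖ρ0‖ ≤ e * s * S := mul_le_mul_of_nonneg_left (by linarith) (by positivity)
      linarith
    have hg : ‖R T - ρT‖ ≤ (e + 1) * S := by
      have : e * ‖ρ0‖ ≤ e * S := mul_le_mul_of_nonneg_left (by linarith) he.le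
      linarith
    calc ‖q‖ ≤ (1 + (|Dmax| + ‖u‖)) * (e * s * (‖R T - ρT‖ + s * ‖StarGraph.adjointSource ρ ρd‖))
          + ‖StarGraph.adjointSource ρ ρd‖ := h1
      _ ≤ (1 + (|Dmax| + ‖u‖)) * (e * s * ((e + 1) * S + s * ((e * s + 1) * S)))
          + (e * s + 1) * S := by gcongr
      _ = _ := by ring
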